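/- **Pinball billiard map.** Let the boundary of an equilateral triangle of side length $1$ be parametrised by arc length $s\in[0,3]$ (counterclockwise, with vertices at $s=0,1,2$ and $s=3$ the same vertex as $s=0$). For $0<\lambda<1$, a particle leaves the non-vertex boundary point $s_0$ at the angle $\theta_0\in(-\frac{\pi}{2},\frac{\pi}{2})$ from the inward normal (positive towards increasing $s$) and moves along a straight line to the next boundary point $s_1$. If $s_1$ is not a vertex, then $T_\lambda(s_0,\theta_0):=(s_1,-\lambda\eta_1)$, where $\eta_1$ is the signed angle from the outward normal at $s_1$ to the incident velocity (with the same sense of rotation). Let $\mathrm{Sing}(\lambda)\subset \tilde M:=[0,3]\times(-\frac{\pi}{2},\frac{\pi}{2})$ be the set of points that lie at a vertex, or whose trajectory hits a vertex after finitely many steps, let $M:=\tilde M\setminus\mathrm{Sing}(\lambda)$, and let $\Gamma_\lambda:=\bigcap_{n\ge 0}T_\lambda^n(M)$ be the attractor. Let $$C(\lambda):=\Big\{\tfrac{\pi}{3}\sum_{n\ge 1}z_n\lambda^n : z_n\in\{1,-1\}\text{ for all } n\ge 1\Big\}.$$ **Theorem.** Let $0<\lambda<\frac13$. Then: 1. $\Gamma_\lambda$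 is invariant, $T_\lambda(\Gamma_\lambda)=\Gamma_\lambda$, and $T_\lambda|_{\Gamma_\lambda}$ is topologically transitive: for all nonempty relatively open $U,V\subset\Gamma_\lambda$ there is $n\ge 0$ with $T_\lambda^n(U)\cap V\neq\emptyset$. 2. $C(\lambda)$ is a Cantor set, and $\Gamma_\lambda$ is equal, hence homeomorphic, to $([0,3]\times C(\lambda))\setminus\mathrm{Sing}(\lambda)$. 3. There is a $T_\lambda$-invariant ergodic Borel probability measure $m$ on $\Gamma_\lambda$ whose conditional measures on the horizontal lines $[0,3]\times\{\theta\}$ are absolutely continuous with respect to Lebesgue measure: $m$ has a disintegration over its projection to the $\theta$-axis, with conditional probability measures $m_\theta$ that are absolutely continuous with respect to Lebesgue measure for every $\theta\in C(\lambda)$. -/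

import Mathlib

open Set MeasureTheory ProbabilityTheory

noncomputable section

namespace Pinball

/-- Unit tangent vector of side `i` of the equilateral triangle of side length `1`
with first vertex `0` and second vertex `1`, traversed counterclockwise
(sides are read modulo `3`). -/
def tangent (i : ℤ) : ℂ := Complex.exp (((2 * Real.pi * i / 3 : ℝ) : ℂ) * Complex.I)

/-- Unit normal vector of side `i` pointing into the triangle. -/
def normal (i : ℤ) : ℂ := Complex.I * tangent i

/-- Arc length parametrization, for `0 ≤ s ≤ 3`, of the boundary of the triangle:
side `i` is the image of `[i, i + 1]`, and the vertices are the images of `0, 1, 2` and `3`,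
where `3` gives the same vertex as `0`. -/
def boundary (s : ℝ) : ℂ :=
  ∑ k ∈ Finset.range ⌊s⌋₊, tangent k + ((Int.fract s : ℝ) : ℂ) * tangent ⌊s⌋

/-- The arc length parameters of the boundary points that are not vertices. -/
def sides : Set ℝ := Ioo 0 1 ∪ Ioo 1 2 ∪ Ioo 2 3

/-- The unit vector that leaves the boundary point of parameter `s` at the signed angle `θ` from
the inward normal, angles being positive towards the direction of increasing arc length. -/
def direction (s θ : ℝ) : ℂ :=
  (Real.cos θ : ℂ) * normal ⌊s⌋ + (Real.sin θ : ℂ) * tangent ⌊s⌋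

/-- One collision of the pinball billiard with parameter `lam`. The particle leaves the boundary
at `p.1` with outgoing angle `p.2` and moves on a straight line; `t` is the time of the next
boundary collision, which takes place at `q.1`. The number `η` is the signed angle from the outward
normal at `q.1` to the incident velocity, and the new outgoing angle is `-lam * η`.
Neither of the two boundary points may be a vertex. -/
def Step (lam : ℝ) (p q : ℝ × ℝ) : Prop :=
  p.1 ∈ sides ∧ p.2 ∈ Ioo (-(Real.pi / 2)) (Real.pi / 2) ∧ q.1 ∈ sides ∧
  (∃ t : ℝ,
    IsLeast {t : ℝ | 0 < t ∧ boundary p.1 + (t : ℂ) * direction p.1 p.2 ∈ boundary '' Icc 0 3} t ∧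
    boundary q.1 = boundary p.1 + (t : ℂ) * direction p.1 p.2) ∧
  ∃ η ∈ Ioo (-(Real.pi / 2)) (Real.pi / 2),
    direction p.1 p.2 = -direction q.1 η ∧ q.2 = -lam * η

/-- The set of points at which the pinball billiard map is defined. -/
def domain (lam : ℝ) : Set (ℝ × ℝ) := {p | ∃ q, Step lam p q}

open Classical in
/-- The pinball billiard map. Its meaningful values are those on `domain lam`, where `Step lam`
determines the image; the points outside are left where they are. -/
def T (lam : ℝ) (p : ℝ × ℝ) : ℝ × ℝ := if h : ∃ q, Step lam p q then h.choose else p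

/-- All pairs of an arc length parameter (with `3` standing for the same vertex as `0`) and an
outgoing angle. -/
def fullSpace : Set (ℝ × ℝ) := Icc 0 3 ×ˢ Ioo (-(Real.pi / 2)) (Real.pi / 2)

/-- The singular locus: the points located at a vertex, or whose trajectory hits a vertex after
finitely many steps. -/
def Sing (lam : ℝ) : Set (ℝ × ℝ) := {p ∈ fullSpace | ∃ n : ℕ, (T lam)^[n] p ∉ domain lam}

/-- The phase space: the points that can be iterated arbitrarily many times. -/
def phaseSpace (lam : ℝ) : Set (ℝ × ℝ) := fullSpace \ Sing lam

/-- The attractor of the pinball billiard map. -/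
def attractor (lam : ℝ) : Set (ℝ × ℝ) := ⋂ n : ℕ, (T lam)^[n] '' phaseSpace lam

/-- The set of the signed geometric series `(π / 3) * ∑ z n * lam ^ n`, over `n ≥ 1`, with signs
`z n = 1` or `z n = -1` (below the index is shifted by one). -/
def C (lam : ℝ) : Set ℝ :=
  {x | ∃ z : ℕ → ℝ, (∀ n, z n = 1 ∨ z n = -1) ∧
    HasSum (fun n : ℕ => Real.pi / 3 * (z n * lam ^ (n + 1))) x}

/-- A Cantor set in `ℝ`: a subset homeomorphic to the Cantor space. -/
def IsCantorSet (K : Set ℝ) : Prop := Nonempty (K ≃ₜ (ℕ → Bool))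

/-- Topological transitivity of a map on an invariant set `A`, with the subspace topology on `A`:
for nonempty relatively open subsets `U ∩ A` and `V ∩ A`, some image of the first meets
the second. -/
def IsTransitiveOn {X : Type*} [TopologicalSpace X] (f : X → X) (A : Set X) : Prop :=
  ∀ U V : Set X, IsOpen U → IsOpen V → (U ∩ A).Nonempty → (V ∩ A).Nonempty →
    ∃ n : ℕ, (f^[n] '' (U ∩ A) ∩ (V ∩ A)).Nonempty

end Pinball

end

/-!
In the coordinates (side `i`, distance `x ∈ (0, 1)` from the start of the side, angle `θ`) the
pinball map is a skew product of baker type. Put `w = (1 + √3 tan θ) / 2` (`hitWeight`). A particle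
with `x > 1 - w` hits the next side, and
`(i, x, θ) ↦ (i + 1, (1 - x) / w, -λ (θ - π / 3))`; a particle with `x < 1 - w` hits the
previous side, and `(i, x, θ) ↦ (i - 1, 1 - x / (1 - w), -λ (θ + π / 3))`; for `x = 1 - w` it
hits a vertex (`step_add_one`, `step_sub_one`, `step_cases`). The formulas hold for all angles in
`(-π / 2, π / 2)`, so the map is measurable, and every collision contracts the distance of the
angle to `C λ` by the factor `λ`. For `λ < 1 / 3` the set `C λ` lies in `(-π / 6, π / 6)`; there
`0 < w < 1`, so both branches map onto whole sides, and each point over `C λ` has a preimage over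
`C λ`. These two facts give the description of the attractor (`attractor_eq`).

If `x` is uniformly distributed and independent of `(i, θ)`, then it is so after the collision,
while `(i, θ)` performs a random walk: `θ` moves by one of two contractions with probabilities
`w` and `1 - w`. Hence the product of Lebesgue measure on the boundary with a stationary measure
`ν` of this walk on `C λ` is invariant, and all its conditional measures on horizontal lines are
the uniform measure on the boundary.

The Markov operator of the walk is studied for a general place-dependent iteration of two
contractions (`PlaceIFS`). A coupling argument shows that the oscillation of its iterates on a
continuous function tends to zero (`PlaceIFS.exists_markov_iterate_sub_le`), which yields `ν` by
the Riesz–Markov–Kakutani theorem, and also mixing of the skew product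
(`PlaceIFS.IsStationary.exists_abs_correlation_le`): the iterates expand each side, so a
continuous function of `x` decorrelates from functions whose means over the sides are nearly
constant. Mixing gives ergodicity, and as the invariant measure has full support on the attractor,
ergodicity gives transitivity.
-/

open Filter Topology CompactlySupported

/-! ### Place-dependent random iteration of two contractions -/


/-- Two contractions of a metric space together with place-dependent probabilities: from the
point `a` one moves to `right a` with probability `weight a` and to `left a` with probability
`1 - weight a`. The weight is Lipschitz and bounded away from `0` and `1`. -/
structure PlaceIFS (K : Type*) [MetricSpace K] where
  /-- the first contraction -/
  right : K → K
  /-- the second contraction -/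
  left : K → K
  /-- the probability of the first contraction -/
  weight : K → ℝ
  /-- a common contraction ratio -/
  ratio : ℝ
  /-- a Lipschitz constant of the weight -/
  slope : ℝ
  /-- a positive lower bound of both probabilities -/
  floor : ℝ
  ratio_nonneg : 0 ≤ ratio
  ratio_lt_one : ratio < 1
  floor_pos : 0 < floor
  dist_right (a b : K) : dist (right a) (right b) ≤ ratio * dist a b
  dist_left (a b : K) : dist (left a) (left b) ≤ ratio * dist a b
  abs_weight_sub_le (a b : K) : |weight a - weight b| ≤ slope * dist a b
  floor_le_weight (a : K) : floor ≤ weight a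
  floor_le_one_sub_weight (a : K) : floor ≤ 1 - weight a

namespace PlaceIFS

variable {K : Type*} [MetricSpace K] (S : PlaceIFS K)

/-- The Markov operator of the random walk on `Fin 3 × K` that moves `(i, a)` to
`(i + 1, right a)` with probability `weight a` and to `(i - 1, left a)` otherwise. -/
def markov (φ : Fin 3 → K → ℝ) : Fin 3 → K → ℝ := fun i a =>
  S.weight a * φ (i + 1) (S.right a) + (1 - S.weight a) * φ (i - 1) (S.left a)

lemma weight_pos (a : K) : 0 < S.weight a := S.floor_pos.trans_le (S.floor_le_weight a)

lemma one_sub_weight_pos (a : K) : 0 < 1 - S.weight a :=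
  S.floor_pos.trans_le (S.floor_le_one_sub_weight a)

lemma continuous_right : Continuous S.right :=
  (LipschitzWith.of_dist_le_mul (K := ⟨S.ratio, S.ratio_nonneg⟩) S.dist_right).continuous

lemma continuous_left : Continuous S.left :=
  (LipschitzWith.of_dist_le_mul (K := ⟨S.ratio, S.ratio_nonneg⟩) S.dist_left).continuous

lemma continuous_weight : Continuous S.weight := by
  refine (LipschitzWith.of_dist_le_mul (K := Real.toNNReal S.slope) fun a b => ?_).continuous
  rw [Real.dist_eq]
  exact (S.abs_weight_sub_le a b).trans
    (mul_le_mul_of_nonneg_right (Real.le_coe_toNNReal _) dist_nonneg)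

lemma markov_continuous {φ : Fin 3 → K → ℝ} (hφ : ∀ i, Continuous (φ i)) (i : Fin 3) :
    Continuous (S.markov φ i) :=
  (S.continuous_weight.mul ((hφ _).comp S.continuous_right)).add
    ((continuous_const.sub S.continuous_weight).mul ((hφ _).comp S.continuous_left))

lemma markov_le {φ : Fin 3 → K → ℝ} {u : ℝ} (h : ∀ i a, φ i a ≤ u) (i : Fin 3) (a : K) :
    S.markov φ i a ≤ u := by
  have h1 := mul_le_mul_of_nonneg_left (h (i + 1) (S.right a)) (S.weight_pos a).le
  have h2 := mul_le_mul_of_nonneg_left (h (i - 1) (S.left a)) (S.one_sub_weight_pos a).le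
  unfold markov
  linarith

lemma le_markov {φ : Fin 3 → K → ℝ} {l : ℝ} (h : ∀ i a, l ≤ φ i a) (i : Fin 3) (a : K) :
    l ≤ S.markov φ i a := by
  have h1 := mul_le_mul_of_nonneg_left (h (i + 1) (S.right a)) (S.weight_pos a).le
  have h2 := mul_le_mul_of_nonneg_left (h (i - 1) (S.left a)) (S.one_sub_weight_pos a).le
  unfold markov
  linarith

lemma markov_iterate_le {φ : Fin 3 → K → ℝ} {u : ℝ} (h : ∀ i a, φ i a ≤ u) (n : ℕ) :
    ∀ i a, S.markov^[n] φ i a ≤ u := by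
  induction n with
  | zero => exact h
  | succ n ih => rw [Function.iterate_succ_apply']; exact S.markov_le ih

lemma le_markov_iterate {φ : Fin 3 → K → ℝ} {l : ℝ} (h : ∀ i a, l ≤ φ i a) (n : ℕ) :
    ∀ i a, l ≤ S.markov^[n] φ i a := by
  induction n with
  | zero => exact h
  | succ n ih => rw [Function.iterate_succ_apply']; exact S.le_markov ih

lemma markov_add (φ ψ : Fin 3 → K → ℝ) : S.markov (φ + ψ) = S.markov φ + S.markov ψ := by
  ext i a; simp only [markov, Pi.add_apply]; ring

lemma markov_smul (c : ℝ) (φ : Fin 3 → K → ℝ) : S.markov (c • φ) = c • S.markov φ := by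
  ext i a; simp only [markov, Pi.smul_apply, smul_eq_mul]; ring

lemma markov_iterate_add (φ ψ : Fin 3 → K → ℝ) (n : ℕ) :
    S.markov^[n] (φ + ψ) = S.markov^[n] φ + S.markov^[n] ψ := by
  induction n with
  | zero => rfl
  | succ n ih => simp only [Function.iterate_succ_apply', ih, markov_add]

lemma markov_iterate_smul (c : ℝ) (φ : Fin 3 → K → ℝ) (n : ℕ) :
    S.markov^[n] (c • φ) = c • S.markov^[n] φ := by
  induction n with
  | zero => rfl
  | succ n ih => simp only [Function.iterate_succ_apply', ih, markov_smul]

/-- Independent coupling of two random choices: if one pair of outcomes has probability at least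
`q` and difference at most `b`, and all the differences are at most `r`, then the difference of the
means is at most `q * b + (1 - q) * r`. -/
lemma mix_sub_mix_le {w v A A' B B' q b r : ℝ} (hw : 0 ≤ w) (hw' : w ≤ 1) (hv : 0 ≤ v)
    (hv' : v ≤ 1) (hq : q ≤ w * v) (hbr : b ≤ r) (h1 : A - B ≤ b) (h2 : A - B' ≤ r)
    (h3 : A' - B ≤ r) (h4 : A' - B' ≤ r) :
    (w * A + (1 - w) * A') - (v * B + (1 - v) * B') ≤ q * b + (1 - q) * r := by
  have e1 := mul_le_mul_of_nonneg_left h1 (mul_nonneg hw hv)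
  have e2 := mul_le_mul_of_nonneg_left h2 (mul_nonneg hw (sub_nonneg.2 hv'))
  have e3 := mul_le_mul_of_nonneg_left h3 (mul_nonneg (sub_nonneg.2 hw') hv)
  have e4 := mul_le_mul_of_nonneg_left h4 (mul_nonneg (sub_nonneg.2 hw') (sub_nonneg.2 hv'))
  have e5 := mul_le_mul_of_nonneg_right hq (sub_nonneg.2 hbr)
  linarith

lemma markov_sub_markov_le {φ : Fin 3 → K → ℝ} {r : ℝ} (h : ∀ i a j b, φ i a - φ j b ≤ r) :
    ∀ i a j b, S.markov φ i a - S.markov φ j b ≤ r := by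
  intro i a j b
  have := mix_sub_mix_le (q := 0) (b := r) (S.weight_pos a).le
    (sub_nonneg.1 (S.one_sub_weight_pos a).le) (S.weight_pos b).le
    (sub_nonneg.1 (S.one_sub_weight_pos b).le)
    (mul_nonneg (S.weight_pos a).le (S.weight_pos b).le) le_rfl
    (h (i + 1) (S.right a) (j + 1) (S.right b)) (h _ _ (j - 1) (S.left b)) (h (i - 1) (S.left a) _ _)
    (h _ _ _ _)
  simpa [markov] using this

lemma markov_iterate_sub_le {φ : Fin 3 → K → ℝ} {r : ℝ} (h : ∀ i a j b, φ i a - φ j b ≤ r) (n : ℕ) :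
    ∀ i a j b, S.markov^[n] φ i a - S.markov^[n] φ j b ≤ r := by
  induction n with
  | zero => exact h
  | succ n ih => rw [Function.iterate_succ_apply']; exact S.markov_sub_markov_le ih

lemma floor_sq_pow_le_one (a : K) (n : ℕ) : (S.floor ^ 2) ^ n ≤ 1 := by
  have h1 := S.floor_le_weight a
  have h2 := S.floor_le_one_sub_weight a
  have h3 := S.floor_pos
  exact pow_le_one₀ (by positivity) (pow_le_one₀ h3.le (by linarith))

/-- Two copies of the random walk started on the same level `i` follow the same `n` choices with
probability at least `floor ^ (2 * n)`, and these choices bring the two points together. -/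
lemma markov_iterate_sub_le_of_dist_le {φ : Fin 3 → K → ℝ} {r e : ℝ} (her : e ≤ r)
    (h : ∀ i a j b, φ i a - φ j b ≤ r) (n : ℕ) : ∀ Δ : ℝ,
    (∀ i a b, dist a b ≤ S.ratio ^ n * Δ → φ i a - φ i b ≤ e) → ∀ i a b, dist a b ≤ Δ →
    S.markov^[n] φ i a - S.markov^[n] φ i b ≤ (S.floor ^ 2) ^ n * e + (1 - (S.floor ^ 2) ^ n) * r := by
  induction n with
  | zero => intro Δ hΔ i a b hab; simpa using hΔ i a b (by simpa using hab)
  | succ n ih =>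
    intro Δ hΔ i a b hab
    have hr := S.markov_iterate_sub_le h n
    have hlast := ih (S.ratio * Δ) (fun i a b hd => hΔ i a b (by rw [pow_succ, mul_assoc]; exact hd))
      (i + 1) (S.right a) (S.right b)
      ((S.dist_right a b).trans (mul_le_mul_of_nonneg_left hab S.ratio_nonneg))
    have hf := S.floor_sq_pow_le_one a n
    have hb : (S.floor ^ 2) ^ n * e + (1 - (S.floor ^ 2) ^ n) * r ≤ r := by
      nlinarith [pow_pos (pow_pos S.floor_pos 2) n]
    have hq : S.floor ^ 2 ≤ S.weight a * S.weight b := by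
      rw [sq]
      exact mul_le_mul (S.floor_le_weight a) (S.floor_le_weight b) S.floor_pos.le
        (S.weight_pos a).le
    have := mix_sub_mix_le (S.weight_pos a).le (sub_nonneg.1 (S.one_sub_weight_pos a).le)
      (S.weight_pos b).le (sub_nonneg.1 (S.one_sub_weight_pos b).le) hq hb hlast
      (hr _ _ (i - 1) (S.left b)) (hr (i - 1) (S.left a) _ _) (hr _ _ _ _)
    simp only [Function.iterate_succ_apply']
    refine this.trans (le_of_eq ?_)
    ring

/-- Two copies of the random walk started anywhere reach the same level after one step with
probability at least `floor ^ 2`, because `1 - (-1) = -1` modulo `3`. -/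
lemma markov_iterate_succ_sub_le {φ : Fin 3 → K → ℝ} {r e Δ : ℝ} (her : e ≤ r)
    (h : ∀ i a j b, φ i a - φ j b ≤ r) (n : ℕ) (hΔ : ∀ a b : K, dist a b ≤ Δ)
    (he : ∀ i a b, dist a b ≤ S.ratio ^ n * Δ → φ i a - φ i b ≤ e) (i : Fin 3) (a : K)
    (j : Fin 3) (b : K) : S.markov^[n + 1] φ i a - S.markov^[n + 1] φ j b ≤
      (S.floor ^ 2) ^ (n + 1) * e + (1 - (S.floor ^ 2) ^ (n + 1)) * r := by
  have hr := S.markov_iterate_sub_le h n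
  have hlast := S.markov_iterate_sub_le_of_dist_le her h n Δ he
  set ψ := S.markov^[n] φ with hψ
  have hf := S.floor_sq_pow_le_one a n
  have hb : (S.floor ^ 2) ^ n * e + (1 - (S.floor ^ 2) ^ n) * r ≤ r := by
    nlinarith [pow_pos (pow_pos S.floor_pos 2) n]
  have hq : ∀ x y : ℝ, S.floor ≤ x → S.floor ≤ y → S.floor ^ 2 ≤ x * y := by
    intro x y hx hy
    rw [sq]
    exact mul_le_mul hx hy S.floor_pos.le (S.floor_pos.le.trans hx)
  have wa := S.weight_pos a
  have wb := S.weight_pos b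
  have wa' := S.one_sub_weight_pos a
  have wb' := S.one_sub_weight_pos b
  have key : S.markov ψ i a - S.markov ψ j b ≤ S.floor ^ 2 *
      ((S.floor ^ 2) ^ n * e + (1 - (S.floor ^ 2) ^ n) * r) + (1 - S.floor ^ 2) * r := by
    unfold markov
    have hcases : ∀ i j : Fin 3, i + 1 = j + 1 ∨ i + 1 = j - 1 ∨ i - 1 = j + 1 := by decide
    rcases hcases i j with hij | hij | hij
    · exact mix_sub_mix_le wa.le (by linarith) wb.le (by linarith)
        (hq _ _ (S.floor_le_weight a) (S.floor_le_weight b)) hb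
        (by rw [hij]; exact hlast _ _ _ (hΔ _ _)) (hr _ _ _ _) (hr _ _ _ _) (hr _ _ _ _)
    · have := mix_sub_mix_le wa.le (by linarith) wb'.le (by linarith)
        (hq _ _ (S.floor_le_weight a) (S.floor_le_one_sub_weight b)) hb
        (A := ψ (i + 1) (S.right a)) (B := ψ (j - 1) (S.left b)) (A' := ψ (i - 1) (S.left a))
        (B' := ψ (j + 1) (S.right b))
        (by rw [hij]; exact hlast _ _ _ (hΔ _ _)) (hr _ _ _ _) (hr _ _ _ _) (hr _ _ _ _)
      linarith
    · have := mix_sub_mix_le wa'.le (by linarith) wb.le (by linarith)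
        (hq _ _ (S.floor_le_one_sub_weight a) (S.floor_le_weight b)) hb
        (A' := ψ (i + 1) (S.right a)) (B' := ψ (j - 1) (S.left b)) (A := ψ (i - 1) (S.left a))
        (B := ψ (j + 1) (S.right b))
        (by rw [hij]; exact hlast _ _ _ (hΔ _ _)) (hr _ _ _ _) (hr _ _ _ _) (hr _ _ _ _)
      linarith
  rw [Function.iterate_succ_apply', ← hψ]
  refine key.trans (le_of_eq ?_)
  ring

/-- The iterates of the Markov operator are equicontinuous: a modulus of continuity of `φ` is
worsened by a Lipschitz term only, which pays for the variation of the weights. -/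
lemma markov_modulus {R D t ω : ℝ} (hD : S.slope * R ≤ (1 - S.ratio) * D) (hD0 : 0 ≤ D)
    (n : ℕ) {φ : Fin 3 → K → ℝ} (hR : ∀ i a j b, φ i a - φ j b ≤ R)
    (hω : ∀ i a b, dist a b ≤ t → φ i a - φ i b ≤ ω + D * dist a b) :
    ∀ i a b, dist a b ≤ t → S.markov^[n] φ i a - S.markov^[n] φ i b ≤ ω + D * dist a b := by
  induction n with
  | zero => exact hω
  | succ n ih =>
    intro i a b hab
    have hr := S.markov_iterate_sub_le hR n
    rw [Function.iterate_succ_apply']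
    set ψ := S.markov^[n] φ
    have hd := dist_nonneg (x := a) (y := b)
    have hle : S.ratio * dist a b ≤ dist a b := mul_le_of_le_one_left hd S.ratio_lt_one.le
    have h1 := ih (i + 1) _ _ ((S.dist_right a b).trans (hle.trans hab))
    have h2 := ih (i - 1) _ _ ((S.dist_left a b).trans (hle.trans hab))
    have d1 := mul_le_mul_of_nonneg_left (S.dist_right a b) hD0
    have d2 := mul_le_mul_of_nonneg_left (S.dist_left a b) hD0
    have e1 := mul_le_mul_of_nonneg_left (h1.trans (add_le_add le_rfl d1)) (S.weight_pos a).le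
    have e2 := mul_le_mul_of_nonneg_left (h2.trans (add_le_add le_rfl d2))
      (S.one_sub_weight_pos a).le
    have e3 : (S.weight a - S.weight b) * (ψ (i + 1) (S.right b) - ψ (i - 1) (S.left b))
        ≤ (1 - S.ratio) * D * dist a b := by
      have habs : |ψ (i + 1) (S.right b) - ψ (i - 1) (S.left b)| ≤ R :=
        abs_le.2 ⟨by linarith [hr (i - 1) (S.left b) (i + 1) (S.right b)], hr _ _ _ _⟩
      calc _ ≤ |S.weight a - S.weight b| * |ψ (i + 1) (S.right b) - ψ (i - 1) (S.left b)| := by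
            rw [← abs_mul]; exact le_abs_self _
        _ ≤ (S.slope * dist a b) * R := mul_le_mul (S.abs_weight_sub_le a b) habs (abs_nonneg _)
            ((abs_nonneg _).trans (S.abs_weight_sub_le a b))
        _ = S.slope * R * dist a b := by ring
        _ ≤ _ := mul_le_mul_of_nonneg_right hD hd
    unfold markov
    linarith

/-- The oscillation of the iterates of the Markov operator on a continuous function tends to zero.
All the iterates share a modulus of continuity, so two points at a small distance `ratio ^ N * Δ`
have values within `2 * e`; the coupling over `N + 1` steps then moves each bound `r` on the
oscillation towards `2 * e` by the fixed proportion `q = floor ^ (2 * (N + 1))`. -/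
lemma exists_markov_iterate_sub_le [CompactSpace K] {φ : Fin 3 → K → ℝ}
    (hφ : ∀ i, Continuous (φ i)) {ε : ℝ} (hε : 0 < ε) :
    ∃ n, ∀ i a j b, S.markov^[n] φ i a - S.markov^[n] φ j b ≤ ε := by
  rcases isEmpty_or_nonempty K with hK | ⟨⟨a₀⟩⟩
  · exact ⟨0, fun i a => (hK.false a).elim⟩
  obtain ⟨e, he, heε⟩ : ∃ e, 0 < e ∧ e + e < ε := ⟨ε / 3, by linarith, by linarith⟩
  have hcont : Continuous (fun y : Fin 3 × K => φ y.1 y.2) :=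
    continuous_prod_of_discrete_left.2 hφ
  obtain ⟨R, hR⟩ : ∃ R, ∀ i a j b, φ i a - φ j b ≤ R := by
    obtain ⟨B, hB⟩ := isCompact_univ.exists_bound_of_continuousOn hcont.continuousOn
    refine ⟨B + B, fun i a j b => ?_⟩
    have h1 := (abs_le.1 (hB (i, a) (mem_univ _))).2
    have h2 := (abs_le.1 (hB (j, b) (mem_univ _))).1
    simp only at h1 h2
    linarith
  have hr1 : 0 < 1 - S.ratio := sub_pos.2 S.ratio_lt_one
  obtain ⟨D, hD0, hD⟩ : ∃ D, 0 ≤ D ∧ S.slope * R ≤ (1 - S.ratio) * D := by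
    refine ⟨|S.slope * R| / (1 - S.ratio), by positivity, ?_⟩
    rw [mul_div_cancel₀ _ hr1.ne']
    exact le_abs_self _
  obtain ⟨t, ht, htφ⟩ : ∃ t > 0, ∀ i a b, dist a b ≤ t → φ i a - φ i b ≤ e := by
    have : ∀ i, ∃ t > 0, ∀ a b, dist a b < t → φ i a - φ i b ≤ e := by
      intro i
      obtain ⟨t, ht, h⟩ := Metric.uniformContinuous_iff.1
        (CompactSpace.uniformContinuous_of_continuous (hφ i)) e he
      refine ⟨t, ht, fun a b hab => ?_⟩
      have := h hab
      rw [Real.dist_eq] at this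
      exact (le_abs_self _).trans this.le
    choose t ht h using this
    obtain ⟨i₀, hi₀⟩ := Finite.exists_min t
    refine ⟨t i₀ / 2, by linarith [ht i₀], fun i a b hab => h i a b ?_⟩
    linarith [ht i₀, hi₀ i]
  obtain ⟨Δ, hΔ⟩ : ∃ Δ, ∀ a b : K, dist a b ≤ Δ :=
    ⟨_, fun a b => Metric.dist_le_diam_of_mem isCompact_univ.isBounded (mem_univ a) (mem_univ b)⟩
  obtain ⟨N, hN⟩ : ∃ N, S.ratio ^ N * Δ ≤ t ∧ D * (S.ratio ^ N * Δ) ≤ e := by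
    have h0 : Tendsto (fun n => S.ratio ^ n * Δ) atTop (𝓝 0) := by
      simpa using (tendsto_pow_atTop_nhds_zero_of_lt_one S.ratio_nonneg S.ratio_lt_one).mul_const Δ
    have h1 : Tendsto (fun n => D * (S.ratio ^ n * Δ)) atTop (𝓝 0) := by simpa using h0.const_mul D
    exact ((h0.eventually_le_const ht).and (h1.eventually_le_const (by linarith : (0 : ℝ) < e))).exists
  have hmod : ∀ n i a b, dist a b ≤ S.ratio ^ N * Δ →
      S.markov^[n] φ i a - S.markov^[n] φ i b ≤ e + e := by
    intro n i a b hab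
    have := S.markov_modulus (t := t) (ω := e) hD hD0 n hR
      (fun i a b h => (htφ i a b h).trans
        (le_add_of_nonneg_right (mul_nonneg hD0 dist_nonneg))) i a b (hab.trans hN.1)
    have h2 := (mul_le_mul_of_nonneg_left hab hD0).trans hN.2
    linarith
  -- the infimum `Ω` of the bounds `r` on the oscillations of the iterates satisfies
  -- `Ω ≤ 2 * q * e + (1 - q) * Ω`, hence `Ω ≤ 2 * e < ε`
  set q := (S.floor ^ 2) ^ (N + 1) with hq
  have hq0 : 0 < q := pow_pos (pow_pos S.floor_pos 2) _
  have hq1 : q ≤ 1 := S.floor_sq_pow_le_one a₀ _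
  set O : Set ℝ := {r | ∃ n, ∀ i a j b, S.markov^[n] φ i a - S.markov^[n] φ j b ≤ r} with hO
  have hne : O.Nonempty := ⟨R, 0, hR⟩
  have hbdd : BddBelow O := ⟨0, by
    rintro r ⟨n, hn⟩
    simpa using hn 0 a₀ 0 a₀⟩
  by_contra hcon
  have hnot : ε ∉ O := hcon
  have hlow : ∀ r ∈ O, ε < r := by
    rintro r ⟨n, hn⟩
    by_contra hre
    exact hnot ⟨n, fun i a j b => (hn i a j b).trans (not_lt.1 hre)⟩
  have hstep : ∀ r ∈ O, sInf O ≤ q * (e + e) + (1 - q) * r := by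
    intro r hr
    have her := heε.le.trans (hlow r hr).le
    obtain ⟨n, hn⟩ := hr
    refine csInf_le hbdd ⟨N + 1 + n, fun i a j b => ?_⟩
    rw [Function.iterate_add_apply]
    exact S.markov_iterate_succ_sub_le her hn N hΔ (hmod n) i a j b
  have hΩ : sInf O ≤ e + e := by
    have : ∀ r ∈ O, (sInf O - q * (e + e)) ≤ (1 - q) * r := fun r hr => by linarith [hstep r hr]
    by_contra hlt
    push Not at hlt
    -- choose `r` in `O` within `q * (Ω - 2 * e) / 2` of the infimum `Ω`
    obtain ⟨r, hr, hrlt⟩ := exists_lt_of_csInf_lt hne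
      (show sInf O < sInf O + q * (sInf O - (e + e)) / 2 by
        have := mul_pos hq0 (sub_pos.2 hlt); linarith)
    have h1 := this r hr
    have h2 := mul_le_mul_of_nonneg_left hrlt.le (sub_nonneg.2 hq1)
    have h3 := mul_pos hq0 (sub_pos.2 hlt)
    nlinarith
  obtain ⟨r, hr, hrlt⟩ := exists_lt_of_csInf_lt hne (hΩ.trans_lt heε)
  exact (hlow r hr).not_gt hrlt

end PlaceIFS

/-! ### The stationary measure -/

namespace PlaceIFS


variable {K : Type*} [MetricSpace K] (S : PlaceIFS K)

/-- On a continuous function the iterates of the Markov operator converge uniformly to a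
constant. -/
lemma exists_forall_markov_iterate_sub_le [CompactSpace K] {φ : Fin 3 → K → ℝ}
    (hφ : ∀ i, Continuous (φ i)) :
    ∃ c : ℝ, ∀ ε > 0, ∃ N, ∀ n ≥ N, ∀ i a, |S.markov^[n] φ i a - c| ≤ ε := by
  rcases isEmpty_or_nonempty K with hK | ⟨⟨a₀⟩⟩
  · exact ⟨0, fun ε _ => ⟨0, fun n _ i a => (hK.false a).elim⟩⟩
  have hosc : ∀ ε > 0, ∃ N, ∀ n ≥ N, ∀ i a j b,
      |S.markov^[n] φ i a - S.markov^[N] φ j b| ≤ ε := by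
    intro ε hε
    obtain ⟨N, hN⟩ := S.exists_markov_iterate_sub_le hφ hε
    refine ⟨N, fun n hn i a j b => ?_⟩
    obtain ⟨k, rfl⟩ := Nat.exists_eq_add_of_le' hn
    rw [Function.iterate_add_apply]
    have h1 := S.markov_iterate_le (φ := S.markov^[N] φ) (u := S.markov^[N] φ j b + ε)
      (fun i a => by linarith [hN i a j b]) k i a
    have h2 := S.le_markov_iterate (φ := S.markov^[N] φ) (l := S.markov^[N] φ j b - ε)
      (fun i a => by linarith [hN j b i a]) k i a
    exact abs_le.2 ⟨by linarith, by linarith⟩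
  have hcauchy : CauchySeq (fun n => S.markov^[n] φ 0 a₀) := by
    refine Metric.cauchySeq_iff'.2 fun ε hε => ?_
    obtain ⟨N, hN⟩ := hosc (ε / 2) (by linarith)
    refine ⟨N, fun n hn => ?_⟩
    rw [Real.dist_eq]
    exact (hN n hn 0 a₀ 0 a₀).trans_lt (by linarith)
  obtain ⟨c, hc⟩ := cauchySeq_tendsto_of_complete hcauchy
  refine ⟨c, fun ε hε => ?_⟩
  obtain ⟨N, hN⟩ := hosc (ε / 2) (by linarith)
  refine ⟨N, fun n hn i a => ?_⟩
  have h1 : |S.markov^[N] φ 0 a₀ - c| ≤ ε / 2 := by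
    rw [abs_sub_comm]
    exact le_of_tendsto ((hc.sub_const _).abs)
      (eventually_atTop.2 ⟨N, fun m hm => hN m hm 0 a₀ 0 a₀⟩)
  have h2 := hN n hn i a 0 a₀
  have := abs_sub_le (S.markov^[n] φ i a) (S.markov^[N] φ 0 a₀) c
  linarith

/-- Existence of a stationary measure: the limit of the iterates of the Markov operator is a
positive functional, which the Riesz–Markov–Kakutani theorem turns into a measure. -/
lemma exists_stationary_integral [CompactSpace K] [Nonempty K] [MeasurableSpace K] [BorelSpace K] :
    ∃ ν : Measure K, IsProbabilityMeasure ν ∧ ∀ φ : K → ℝ, Continuous φ →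
      ∫ a, (S.weight a * φ (S.right a) + (1 - S.weight a) * φ (S.left a)) ∂ν = ∫ a, φ a ∂ν := by
  obtain ⟨a₀⟩ := ‹Nonempty K›
  have hlim : ∀ φ : K → ℝ, Continuous φ → ∃ c, Tendsto
      (fun n => S.markov^[n] (fun _ => φ) 0 a₀) atTop (𝓝 c) := by
    intro φ hφ
    obtain ⟨c, hc⟩ := S.exists_forall_markov_iterate_sub_le (φ := fun _ => φ) (fun _ => hφ)
    refine ⟨c, Metric.tendsto_atTop.2 fun ε hε => ?_⟩
    obtain ⟨N, hN⟩ := hc (ε / 2) (by linarith)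
    refine ⟨N, fun n hn => ?_⟩
    rw [Real.dist_eq]
    exact (hN n hn 0 a₀).trans_lt (by linarith)
  choose! Λ hΛ using hlim
  let Λ' : C_c(K, ℝ) →ₚ[ℝ] ℝ :=
  { toFun := fun g => Λ g
    map_add' g g' := by
      refine tendsto_nhds_unique (hΛ _ (g + g').continuous) ?_
      convert! (hΛ _ g.continuous).add (hΛ _ g'.continuous) using 2 with n
      exact congrFun (congrFun (S.markov_iterate_add (fun _ => g) (fun _ => g') n) 0) a₀
    map_smul' c g := by
      refine tendsto_nhds_unique (hΛ _ (c • g).continuous) ?_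
      convert! (hΛ _ g.continuous).const_smul c using 2 with n
      exact congrFun (congrFun (S.markov_iterate_smul c (fun _ => g) n) 0) a₀
    monotone' g g' hgg' := by
      have h := (hΛ _ g'.continuous).add ((hΛ _ g.continuous).const_smul (-1 : ℝ))
      have h0 : 0 ≤ Λ g' + (-1 : ℝ) • Λ g := by
        refine ge_of_tendsto' h fun n => ?_
        have e := congrFun (congrFun (S.markov_iterate_add (fun _ => ⇑g')
          ((-1 : ℝ) • fun _ => ⇑g) n) 0) a₀
        rw [S.markov_iterate_smul] at e
        refine le_trans ?_ (le_of_eq e)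
        refine S.le_markov_iterate (fun i a => ?_) n 0 a₀
        have := hgg' a
        simp only [Pi.add_apply, Pi.smul_apply, smul_eq_mul]
        linarith
      simp only [smul_eq_mul] at h0
      linarith }
  let ν := RealRMK.rieszMeasure Λ'
  have hint : ∀ φ : K → ℝ, Continuous φ → ∫ a, φ a ∂ν = Λ φ := fun φ hφ =>
    RealRMK.integral_rieszMeasure Λ' ⟨⟨φ, hφ⟩, HasCompactSupport.of_compactSpace _⟩
  have h1 : Λ (fun _ => 1) = 1 := by
    refine tendsto_nhds_unique (hΛ _ continuous_const) ?_
    refine tendsto_const_nhds.congr fun n => ?_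
    exact le_antisymm (S.le_markov_iterate (fun _ _ => le_rfl) n 0 a₀)
      (S.markov_iterate_le (fun _ _ => le_rfl) n 0 a₀)
  refine ⟨ν, ⟨?_⟩, fun φ hφ => ?_⟩
  · have := hint (fun _ => (1 : ℝ)) continuous_const
    rw [h1, integral_const, smul_eq_mul, mul_one] at this
    have h2 : ν univ = ENNReal.ofReal 1 := by
      rw [← this, Measure.real, ENNReal.ofReal_toReal]
      intro h
      simp [Measure.real, h] at this
    simpa using h2
  · have hcont : Continuous fun a =>
        S.weight a * φ (S.right a) + (1 - S.weight a) * φ (S.left a) :=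
      S.markov_continuous (φ := fun _ => φ) (fun _ => hφ) 0
    rw [hint _ hφ, hint _ hcont]
    refine tendsto_nhds_unique (hΛ _ hcont) ?_
    refine ((hΛ _ hφ).comp (tendsto_add_atTop_nat 1)).congr fun n => ?_
    exact congrFun (congrFun (Function.iterate_succ_apply S.markov n (fun _ => φ)) 0) a₀

/-- A probability measure is stationary if it is reproduced by one random step. -/
def IsStationary [MeasurableSpace K] (ν : Measure K) : Prop :=
  ν = (ν.withDensity fun a => ENNReal.ofReal (S.weight a)).map S.right +
    (ν.withDensity fun a => ENNReal.ofReal (1 - S.weight a)).map S.left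

lemma exists_isStationary [CompactSpace K] [Nonempty K] [MeasurableSpace K] [BorelSpace K] :
    ∃ ν : Measure K, IsProbabilityMeasure ν ∧ S.IsStationary ν := by
  obtain ⟨ν, hν, h⟩ := S.exists_stationary_integral
  refine ⟨ν, hν, ?_⟩
  have hw := S.continuous_weight
  have hr := S.continuous_right
  have hl := S.continuous_left
  have i1 : Integrable S.weight ν := hw.integrable_of_hasCompactSupport (.of_compactSpace _)
  have i2 : Integrable (fun a => 1 - S.weight a) ν :=
    (continuous_const.sub hw).integrable_of_hasCompactSupport (.of_compactSpace _)
  have f1 := isFiniteMeasure_withDensity_ofReal i1.2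
  have f2 := isFiniteMeasure_withDensity_ofReal i2.2
  have hcont : ∀ f : K → ℝ, Continuous f → Continuous fun a => (ENNReal.ofReal (f a)).toReal := by
    intro f hf
    simpa only [ENNReal.toReal_ofReal'] using hf.max continuous_const
  refine ext_of_forall_integral_eq_of_IsFiniteMeasure fun φ => ?_
  rw [← h φ φ.continuous, integral_add_measure, integral_map, integral_map,
    integral_withDensity_eq_integral_toReal_smul, integral_withDensity_eq_integral_toReal_smul,
    ← integral_add]
  · refine integral_congr_ae (.of_forall fun a => ?_)
    simp only [smul_eq_mul]
    rw [ENNReal.toReal_ofReal (S.weight_pos a).le, ENNReal.toReal_ofReal (S.one_sub_weight_pos a).le]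
  · exact ((hcont _ hw).smul
      (φ.continuous.comp hr)).integrable_of_hasCompactSupport (.of_compactSpace _)
  · exact ((hcont _ (continuous_const.sub hw)).smul
      (φ.continuous.comp hl)).integrable_of_hasCompactSupport (.of_compactSpace _)
  · exact (continuous_const.sub hw).measurable.ennreal_ofReal
  · exact .of_forall fun _ => ENNReal.ofReal_lt_top
  · exact hw.measurable.ennreal_ofReal
  · exact .of_forall fun _ => ENNReal.ofReal_lt_top
  · exact hl.measurable.aemeasurable
  · exact φ.continuous.aestronglyMeasurable
  · exact hr.measurable.aemeasurable
  · exact φ.continuous.aestronglyMeasurable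
  · exact φ.integrable _
  · exact φ.integrable _

variable {S}

lemma IsStationary.lintegral_eq [MeasurableSpace K] [BorelSpace K] {ν : Measure K}
    (h : S.IsStationary ν) {F : K → ENNReal} (hF : Measurable F) :
    ∫⁻ a, F a ∂ν = ∫⁻ a, (ENNReal.ofReal (S.weight a) * F (S.right a) +
      ENNReal.ofReal (1 - S.weight a) * F (S.left a)) ∂ν := by
  have hw := S.continuous_weight.measurable
  have hr := S.continuous_right.measurable
  have hl := S.continuous_left.measurable
  conv_lhs => rw [h]
  rw [lintegral_add_measure, lintegral_map hF hr, lintegral_map hF hl,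
    lintegral_withDensity_eq_lintegral_mul _ hw.ennreal_ofReal (g := fun a => F (S.right a)) (hF.comp hr),
    lintegral_withDensity_eq_lintegral_mul _ (f := fun a => ENNReal.ofReal (1 - S.weight a))
      (measurable_const.sub hw).ennreal_ofReal
      (g := fun a => F (S.left a)) (hF.comp hl)]
  exact (lintegral_add_left (hw.ennreal_ofReal.mul (hF.comp hr)) _).symm

/-- If the two contractions cover the space, then a stationary measure has full support: a small
ball contains the image of the whole space under a composition of the contractions. -/
lemma IsStationary.ball_pos [CompactSpace K] [MeasurableSpace K] [BorelSpace K] {ν : Measure K}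
    [IsProbabilityMeasure ν] (h : S.IsStationary ν)
    (hcover : ∀ a, (∃ b, S.right b = a) ∨ ∃ b, S.left b = a) (a : K) {r : ℝ} (hr : 0 < r) :
    0 < ν (Metric.ball a r) := by
  obtain ⟨Δ, hΔ⟩ : ∃ Δ, ∀ a b : K, dist a b ≤ Δ :=
    ⟨_, fun a b => Metric.dist_le_diam_of_mem isCompact_univ.isBounded (mem_univ a) (mem_univ b)⟩
  have main : ∀ n : ℕ, ∀ a r, S.ratio ^ n * Δ < r → 0 < ν (Metric.ball a r) := by
    intro n
    induction n with
    | zero =>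
      intro a r har
      have : Metric.ball a r = univ := eq_univ_of_forall fun b => by
        have := hΔ b a
        rw [Metric.mem_ball]
        simp only [pow_zero, one_mul] at har
        linarith
      simp [this]
    | succ n ih =>
      intro a r har
      obtain ⟨r', hr', hrr'⟩ : ∃ r', S.ratio ^ n * Δ < r' ∧ S.ratio * r' ≤ r := by
        rcases S.ratio_nonneg.eq_or_lt with h0 | h0
        · refine ⟨S.ratio ^ n * Δ + 1, by linarith, ?_⟩
          rw [← h0] at har ⊢
          simpa using har.le
        · refine ⟨r / S.ratio, (lt_div_iff₀ h0).2 (by rw [pow_succ] at har; linarith), ?_⟩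
          rw [mul_div_cancel₀ _ h0.ne']
      have hw : 0 < ENNReal.ofReal S.floor := ENNReal.ofReal_pos.2 S.floor_pos
      have heq := h.lintegral_eq (F := (Metric.ball a r).indicator 1)
        (measurable_one.indicator measurableSet_ball)
      rw [lintegral_indicator_one measurableSet_ball] at heq
      rw [heq]
      have key : ∀ b, ∀ f : K → K, (∀ x y, dist (f x) (f y) ≤ S.ratio * dist x y) → f b = a →
          ∀ x ∈ Metric.ball b r', f x ∈ Metric.ball a r := by
        intro b f hf hb x hx
        rw [Metric.mem_ball, ← hb]
        rcases S.ratio_nonneg.eq_or_lt with h0 | h0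
        · have := hf x b
          rw [← h0] at this har
          refine this.trans_lt ?_
          simpa using har
        · exact (hf x b).trans_lt ((mul_lt_mul_of_pos_left (Metric.mem_ball.1 hx) h0).trans_le hrr')
      have hlow : ∀ b, (∀ x ∈ Metric.ball b r', ENNReal.ofReal S.floor ≤
          ENNReal.ofReal (S.weight x) * (Metric.ball a r).indicator 1 (S.right x) +
          ENNReal.ofReal (1 - S.weight x) * (Metric.ball a r).indicator 1 (S.left x)) →
          0 < ∫⁻ x, (ENNReal.ofReal (S.weight x) * (Metric.ball a r).indicator 1 (S.right x) +
          ENNReal.ofReal (1 - S.weight x) * (Metric.ball a r).indicator 1 (S.left x)) ∂ν := by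
        intro b hb
        calc (0 : ENNReal) < ENNReal.ofReal S.floor * ν (Metric.ball b r') :=
              ENNReal.mul_pos hw.ne' (ih b r' hr').ne'
          _ = ∫⁻ x in Metric.ball b r', ENNReal.ofReal S.floor ∂ν := by rw [setLIntegral_const]
          _ ≤ _ := setLIntegral_mono' measurableSet_ball hb
          _ ≤ _ := setLIntegral_le_lintegral _ _
      rcases hcover a with ⟨b, hb⟩ | ⟨b, hb⟩
      · refine hlow b fun x hx => le_add_of_le_of_nonneg ?_ zero_le
        rw [indicator_of_mem (key b _ S.dist_right hb x hx), Pi.one_apply, mul_one]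
        exact ENNReal.ofReal_le_ofReal (S.floor_le_weight x)
      · refine hlow b fun x hx => le_add_of_nonneg_of_le zero_le ?_
        rw [indicator_of_mem (key b _ S.dist_left hb x hx), Pi.one_apply, mul_one]
        exact ENNReal.ofReal_le_ofReal (S.floor_le_one_sub_weight x)
  have h0 : Tendsto (fun n => S.ratio ^ n * Δ) atTop (𝓝 0) := by
    simpa using (tendsto_pow_atTop_nhds_zero_of_lt_one S.ratio_nonneg S.ratio_lt_one).mul_const Δ
  obtain ⟨n, hn⟩ := (h0.eventually_lt_const hr).exists
  exact main n a r hn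

end PlaceIFS

/-! ### The skew product over a place-dependent iteration -/

/-- Lebesgue measure on the unit interval. -/
noncomputable def unitLeb : Measure ℝ := volume.restrict (Ioo 0 1)

instance : IsProbabilityMeasure unitLeb := ⟨by simp [unitLeb]⟩

/-- Lebesgue measure on the unit interval is self-similar under the two affine maps that map the
unit interval, with reversed orientation, onto `[0, 1 - w]` and `[1 - w, 1]`. -/
lemma unitLeb_eq {w : ℝ} (h0 : 0 < w) (h1 : 0 < 1 - w) :
    unitLeb = ENNReal.ofReal w • unitLeb.map (fun y => 1 - w * y) +
      ENNReal.ofReal (1 - w) • unitLeb.map (fun y => (1 - w) * (1 - y)) := by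
  refine Measure.ext_of_lintegral _ fun F hF => ?_
  have m1 : Measurable fun y : ℝ => 1 - w * y := by fun_prop
  have m2 : Measurable fun y : ℝ => (1 - w) * (1 - y) := by fun_prop
  rw [lintegral_add_measure, lintegral_smul_measure, lintegral_smul_measure, lintegral_map hF m1,
    lintegral_map hF m2]
  have im1 : (fun y : ℝ => 1 - w * y) '' Ioo 0 1 = Ioo (1 - w) 1 := by
    ext x
    simp only [mem_image, mem_Ioo]
    constructor
    · rintro ⟨y, ⟨hy0, hy1⟩, rfl⟩
      constructor <;> nlinarith
    · rintro ⟨hx0, hx1⟩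
      exact ⟨(1 - x) / w, ⟨div_pos (by linarith) h0, (div_lt_one h0).2 (by linarith)⟩, by
        field_simp; ring⟩
  have im2 : (fun y : ℝ => (1 - w) * (1 - y)) '' Ioo 0 1 = Ioo 0 (1 - w) := by
    ext x
    simp only [mem_image, mem_Ioo]
    constructor
    · rintro ⟨y, ⟨hy0, hy1⟩, rfl⟩
      constructor <;> nlinarith
    · rintro ⟨hx0, hx1⟩
      exact ⟨1 - x / (1 - w), ⟨sub_pos.2 ((div_lt_one h1).2 hx1), by
        have := div_pos hx0 h1; linarith⟩, by field_simp; ring⟩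
  have c1 := lintegral_image_eq_lintegral_abs_deriv_mul (s := Ioo (0 : ℝ) 1) measurableSet_Ioo
    (f := fun y => 1 - w * y) (f' := fun _ => -w)
    (fun x _ => by simpa using ((hasDerivAt_id x).const_mul w).const_sub 1 |>.hasDerivWithinAt)
    (fun x _ y _ h => by
      have : w * x = w * y := by simpa using h
      exact mul_left_cancel₀ h0.ne' this) F
  have c2 := lintegral_image_eq_lintegral_abs_deriv_mul (s := Ioo (0 : ℝ) 1) measurableSet_Ioo
    (f := fun y => (1 - w) * (1 - y)) (f' := fun _ => -(1 - w))
    (fun x _ => by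
      simpa using (((hasDerivAt_id x).const_sub 1).const_mul (1 - w)).hasDerivWithinAt)
    (fun x _ y _ h => by
      have := mul_left_cancel₀ h1.ne' h
      linarith) F
  rw [im1] at c1
  rw [im2] at c2
  simp only [abs_neg, abs_of_pos h0, abs_of_pos h1] at c1 c2
  rw [lintegral_const_mul _ (f := fun y => F (1 - w * y)) (hF.comp m1)] at c1
  rw [lintegral_const_mul _ (f := fun y => F ((1 - w) * (1 - y))) (hF.comp m2)] at c2
  unfold unitLeb
  rw [smul_eq_mul, smul_eq_mul, ← c1, ← c2, add_comm, setLIntegral_congr (Ioo_ae_eq_Ioc (a := (0 : ℝ)) (b := 1 - w)),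
    ← lintegral_union measurableSet_Ioo
      (disjoint_left.2 fun x hx hx' => hx'.1.not_ge hx.2),
    Ioc_union_Ioo_eq_Ioo h1.le (by linarith)]

lemma integral_unitLeb_eq {w : ℝ} (h0 : 0 < w) (h1 : 0 < 1 - w) {f : ℝ → ℝ}
    (hfm : Measurable f) (hf : Integrable f unitLeb) : ∫ x, f x ∂unitLeb = w * ∫ y, f (1 - w * y) ∂unitLeb +
      (1 - w) * ∫ y, f ((1 - w) * (1 - y)) ∂unitLeb := by
  have h := hf
  rw [unitLeb_eq h0 h1] at h
  obtain ⟨i1, i2⟩ := integrable_add_measure.1 h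
  conv_lhs => rw [unitLeb_eq h0 h1]
  rw [integral_add_measure i1 i2, integral_smul_measure, integral_smul_measure,
    integral_map (by fun_prop) hfm.aestronglyMeasurable,
    integral_map (by fun_prop) hfm.aestronglyMeasurable,
    ENNReal.toReal_ofReal h0.le, ENNReal.toReal_ofReal h1.le, smul_eq_mul, smul_eq_mul]

namespace PlaceIFS

variable {K : Type*} [MetricSpace K] (S : PlaceIFS K)

open Classical in
/-- The baker-like skew product over the random iteration: on the copy `i` of the unit interval
over `a`, the piece above `1 - weight a` is stretched onto the copy `i + 1` over `right a`, and
the piece below onto the copy `i - 1` over `left a`, both with reversed orientation. -/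
noncomputable def skew (p : (Fin 3 × ℝ) × K) : (Fin 3 × ℝ) × K :=
  if 1 - S.weight p.2 < p.1.2 then
    ((p.1.1 + 1, (1 - p.1.2) / S.weight p.2), S.right p.2)
  else ((p.1.1 - 1, 1 - p.1.2 / (1 - S.weight p.2)), S.left p.2)

lemma skew_right (i : Fin 3) {y : ℝ} (hy : y ∈ Ioo (0 : ℝ) 1) (a : K) :
    S.skew ((i, 1 - S.weight a * y), a) = ((i + 1, y), S.right a) := by
  have hw := S.weight_pos a
  have : 1 - S.weight a < 1 - S.weight a * y := by nlinarith [hy.2]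
  simp only [skew, this, if_true]
  congr 2
  field_simp
  ring

lemma skew_left (i : Fin 3) {y : ℝ} (hy : y ∈ Ioo (0 : ℝ) 1) (a : K) :
    S.skew ((i, (1 - S.weight a) * (1 - y)), a) = ((i - 1, y), S.left a) := by
  have hw := S.one_sub_weight_pos a
  have : ¬ 1 - S.weight a < (1 - S.weight a) * (1 - y) := by nlinarith [hy.1]
  simp only [skew, this, if_false]
  congr 2
  field_simp
  ring

variable [MeasurableSpace K] [BorelSpace K]

lemma measurable_skew : Measurable S.skew := by
  have hw := S.continuous_weight.measurable
  have hr := S.continuous_right.measurable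
  have hl := S.continuous_left.measurable
  have hadd : Measurable fun i : Fin 3 => i + 1 := measurable_from_top
  have hsub : Measurable fun i : Fin 3 => i - 1 := measurable_from_top
  refine Measurable.ite (measurableSet_lt (by fun_prop) (by fun_prop)) ?_ ?_
  · exact ((hadd.comp (by fun_prop)).prodMk (by fun_prop)).prodMk (by fun_prop)
  · exact ((hsub.comp (by fun_prop)).prodMk (by fun_prop)).prodMk (by fun_prop)

/-- The mean of a function over the copy `i` of the unit interval above the point `a`. -/
noncomputable def sliceMean (G : (Fin 3 × ℝ) × K → ℝ) : Fin 3 → K → ℝ := fun i a =>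
  ∫ x, G ((i, x), a) ∂unitLeb

lemma integrable_slice {L : Type*} [MeasurableSpace L] {G : (Fin 3 × ℝ) × L → ℝ}
    (hG : Measurable G) {B : ℝ} (hB : ∀ p, |G p| ≤ B) (i : Fin 3) (a : L) : Integrable (fun x => G ((i, x), a)) unitLeb :=
  .of_bound (C := B) (hG.comp (by fun_prop)).aestronglyMeasurable (.of_forall fun _ => hB _)

/-- One step of the transfer operator along a copy of the unit interval, by the self-similarity
`unitLeb_eq`. -/
lemma integral_mul_comp_skew {u : ℝ → ℝ} (hu : Measurable u) {M : ℝ} (hM : ∀ x, |u x| ≤ M)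
    {G : (Fin 3 × ℝ) × K → ℝ} (hG : Measurable G) {B : ℝ} (hB : ∀ p, |G p| ≤ B) (i : Fin 3)
    (a : K) : ∫ x, u x * G (S.skew ((i, x), a)) ∂unitLeb =
      S.weight a * ∫ y, u (1 - S.weight a * y) * G ((i + 1, y), S.right a) ∂unitLeb +
      (1 - S.weight a) *
        ∫ y, u ((1 - S.weight a) * (1 - y)) * G ((i - 1, y), S.left a) ∂unitLeb := by
  have hmem : ∀ᵐ y ∂unitLeb, y ∈ Ioo (0 : ℝ) 1 := ae_restrict_mem measurableSet_Ioo
  rw [integral_unitLeb_eq (S.weight_pos a) (S.one_sub_weight_pos a)]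
  · congr 2
    · refine integral_congr_ae ?_
      filter_upwards [hmem] with y hy
      rw [S.skew_right i hy]
    · refine integral_congr_ae ?_
      filter_upwards [hmem] with y hy
      rw [S.skew_left i hy]
  · exact hu.mul (hG.comp (S.measurable_skew.comp (by fun_prop)))
  · have hm := S.measurable_skew
    refine .of_bound (C := M * B) (hu.mul (hG.comp (hm.comp (by fun_prop)))).aestronglyMeasurable
      (.of_forall fun x => ?_)
    rw [norm_mul]
    exact mul_le_mul (hM _) (hB _) (norm_nonneg _) ((abs_nonneg _).trans (hM x))

lemma sliceMean_comp_skew {G : (Fin 3 × ℝ) × K → ℝ} (hG : Measurable G) {B : ℝ}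
    (hB : ∀ p, |G p| ≤ B) : sliceMean (G ∘ S.skew) = S.markov (sliceMean G) := by
  ext i a
  simpa [sliceMean, markov] using
    S.integral_mul_comp_skew (u := fun _ => 1) measurable_const (M := 1) (by simp) hG hB i a

lemma sliceMean_comp_skew_iterate {G : (Fin 3 × ℝ) × K → ℝ} (hG : Measurable G) {B : ℝ}
    (hB : ∀ p, |G p| ≤ B) (n : ℕ) :
    sliceMean (G ∘ S.skew^[n]) = S.markov^[n] (sliceMean G) := by
  induction n with
  | zero => rfl
  | succ n ih =>
    rw [Function.iterate_succ, ← Function.comp_assoc,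
      S.sliceMean_comp_skew (hG.comp (S.measurable_skew.iterate n)) (fun p => hB _), ih,
      Function.iterate_succ_apply']

/-- Decorrelation along one copy of the unit interval: since `skew^[k]` stretches the pieces of
the interval that follow the same itinerary onto whole copies, a function `u` that is nearly
constant at the scale of these pieces hardly correlates with a function `H` whose means over
the copies are small. -/
lemma abs_integral_mul_comp_skew_iterate_le {H : (Fin 3 × ℝ) × K → ℝ} (hH : Measurable H)
    {B ε : ℝ} (hB : ∀ p, |H p| ≤ B) (hε : ∀ i a, |sliceMean H i a| ≤ ε) {M ω : ℝ} (hω0 : 0 ≤ ω)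
    (k : ℕ) :
    ∀ u : ℝ → ℝ, Measurable u → (∀ x, |u x| ≤ M) →
      (∀ x ∈ Ioo (0 : ℝ) 1, ∀ y ∈ Ioo (0 : ℝ) 1,
        |x - y| ≤ (1 - S.floor) ^ k → |u x - u y| ≤ ω) →
      ∀ i a, |∫ x, u x * H (S.skew^[k] ((i, x), a)) ∂unitLeb| ≤ M * ε + ω * B := by
  induction k with
  | zero =>
    intro u hu hM hω i a
    have hmem : ∀ᵐ y ∂unitLeb, y ∈ Ioo (0 : ℝ) 1 := ae_restrict_mem measurableSet_Ioo
    have hhalf : (1 / 2 : ℝ) ∈ Ioo (0 : ℝ) 1 := by norm_num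
    have hclose : ∀ᵐ x ∂unitLeb, ‖(u x - u (1 / 2)) * H ((i, x), a)‖ ≤ ω * B := by
      filter_upwards [hmem] with x hx
      rw [norm_mul]
      refine mul_le_mul (hω x hx _ hhalf ?_) (hB _) (norm_nonneg _) hω0
      rw [pow_zero]
      exact abs_le.2 ⟨by linarith [hx.1], by linarith [hx.2]⟩
    have hint : Integrable (fun x => (u x - u (1 / 2)) * H ((i, x), a)) unitLeb :=
      .of_bound (((hu.sub measurable_const).mul
        (hH.comp (by fun_prop : Measurable fun x : ℝ => ((i, x), a)))).aestronglyMeasurable)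
        (ω * B) hclose
    have h1 := norm_integral_le_of_norm_le_const hclose
    simp only [probReal_univ, mul_one] at h1
    have h2 : ∫ x, u x * H ((i, x), a) ∂unitLeb =
        ∫ x, (u x - u (1 / 2)) * H ((i, x), a) ∂unitLeb + u (1 / 2) * sliceMean H i a := by
      rw [sliceMean, ← integral_const_mul, ← integral_add hint
        ((integrable_slice hH hB i a).const_mul _)]
      congr 1
      ext x
      ring
    simp only [Function.iterate_zero, id_eq]
    rw [h2]
    refine (abs_add_le _ _).trans ?_
    rw [abs_mul, add_comm]
    exact add_le_add (mul_le_mul (hM _) (hε i a) (abs_nonneg _) ((abs_nonneg _).trans (hM 0))) h1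
  | succ k ih =>
    intro u hu hM hω i a
    have hw := S.weight_pos a
    have hw' := S.one_sub_weight_pos a
    have hfl := S.floor_le_weight a
    have hfl' := S.floor_le_one_sub_weight a
    simp only [Function.iterate_succ_apply]
    have hsplit := S.integral_mul_comp_skew hu hM (G := fun p => H (S.skew^[k] p))
      (hH.comp (S.measurable_skew.iterate k)) (fun p => hB _) i a
    rw [hsplit]
    have h1 := ih (fun y => u (1 - S.weight a * y)) (hu.comp (by fun_prop)) (fun x => hM _)
      (fun x hx y hy hxy => by
        refine hω _ ?_ _ ?_ ?_
        · constructor <;> nlinarith [hx.1, hx.2]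
        · constructor <;> nlinarith [hy.1, hy.2]
        · rw [show 1 - S.weight a * x - (1 - S.weight a * y) = -(S.weight a * (x - y)) by ring,
            abs_neg, abs_mul, abs_of_pos hw, pow_succ']
          exact mul_le_mul (by linarith) hxy (abs_nonneg _) (by linarith)) (i + 1) (S.right a)
    have h2 := ih (fun y => u ((1 - S.weight a) * (1 - y))) (hu.comp (by fun_prop)) (fun x => hM _)
      (fun x hx y hy hxy => by
        refine hω _ ?_ _ ?_ ?_
        · constructor <;> nlinarith [hx.1, hx.2]
        · constructor <;> nlinarith [hy.1, hy.2]
        · rw [show (1 - S.weight a) * (1 - x) - (1 - S.weight a) * (1 - y) =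
              -((1 - S.weight a) * (x - y)) by ring, abs_neg, abs_mul, abs_of_pos hw', pow_succ']
          exact mul_le_mul (by linarith) hxy (abs_nonneg _) (by linarith)) (i - 1) (S.left a)
    refine (abs_add_le _ _).trans ?_
    rw [abs_mul, abs_mul, abs_of_pos hw, abs_of_pos hw']
    have e1 := mul_le_mul_of_nonneg_left h1 hw.le
    have e2 := mul_le_mul_of_nonneg_left h2 hw'.le
    linarith

end PlaceIFS

/-! ### Ergodicity of the skew product -/

namespace PlaceIFS

/-- The uniform probability measure on the three copies of the unit interval. -/
noncomputable def circleLeb : Measure (Fin 3 × ℝ) :=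
  (((3 : ENNReal)⁻¹ • Measure.count : Measure (Fin 3))).prod unitLeb

instance : IsProbabilityMeasure ((3 : ENNReal)⁻¹ • Measure.count : Measure (Fin 3)) := ⟨by
  simp [Measure.count_apply, ENNReal.inv_mul_cancel]⟩

instance : IsProbabilityMeasure circleLeb := by unfold circleLeb; infer_instance

lemma lintegral_circleLeb {F : Fin 3 × ℝ → ENNReal} (hF : Measurable F) :
    ∫⁻ p, F p ∂circleLeb = 3⁻¹ * ∑ i, ∫⁻ x, F (i, x) ∂unitLeb := by
  rw [circleLeb, lintegral_prod _ hF.aemeasurable, lintegral_smul_measure, lintegral_count,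
    tsum_fintype, smul_eq_mul]

lemma integral_circleLeb {F : Fin 3 × ℝ → ℝ} (hF : Integrable F circleLeb) :
    ∫ p, F p ∂circleLeb = 3⁻¹ * ∑ i, ∫ x, F (i, x) ∂unitLeb := by
  rw [circleLeb, integral_prod _ hF, integral_smul_measure, integral_count]
  simp

variable {K : Type*} [MetricSpace K] (S : PlaceIFS K) [MeasurableSpace K] [BorelSpace K]

lemma lintegral_unitLeb_comp_skew {F : (Fin 3 × ℝ) × K → ENNReal} (hF : Measurable F) (i : Fin 3)
    (a : K) : ∫⁻ x, F (S.skew ((i, x), a)) ∂unitLeb =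
      ENNReal.ofReal (S.weight a) * ∫⁻ y, F ((i + 1, y), S.right a) ∂unitLeb +
      ENNReal.ofReal (1 - S.weight a) * ∫⁻ y, F ((i - 1, y), S.left a) ∂unitLeb := by
  have hmem : ∀ᵐ y ∂unitLeb, y ∈ Ioo (0 : ℝ) 1 := ae_restrict_mem measurableSet_Ioo
  have hm : Measurable fun x : ℝ => F (S.skew ((i, x), a)) :=
    hF.comp (S.measurable_skew.comp (by fun_prop))
  conv_lhs => rw [unitLeb_eq (S.weight_pos a) (S.one_sub_weight_pos a)]
  rw [lintegral_add_measure, lintegral_smul_measure, lintegral_smul_measure,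
    lintegral_map hm (by fun_prop), lintegral_map hm (by fun_prop), smul_eq_mul, smul_eq_mul]
  congr 2
  · refine lintegral_congr_ae ?_
    filter_upwards [hmem] with y hy
    rw [S.skew_right i hy]
  · refine lintegral_congr_ae ?_
    filter_upwards [hmem] with y hy
    rw [S.skew_left i hy]

variable {S} {ν : Measure K} [IsProbabilityMeasure ν]

lemma IsStationary.measurePreserving_skew (h : S.IsStationary ν) :
    MeasurePreserving S.skew (circleLeb.prod ν) (circleLeb.prod ν) := by
  refine ⟨S.measurable_skew, Measure.ext_of_lintegral _ fun F hF => ?_⟩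
  have hFs : Measurable fun p => F (S.skew p) := hF.comp S.measurable_skew
  rw [lintegral_map hF S.measurable_skew, lintegral_prod_symm' _ hFs, lintegral_prod_symm' _ hF,
    h.lintegral_eq hF.lintegral_prod_left']
  refine lintegral_congr fun a => ?_
  have hm : ∀ b : K, Measurable fun p : Fin 3 × ℝ => F (p, b) := fun b => hF.comp (by fun_prop)
  rw [lintegral_circleLeb (F := fun p => F (S.skew (p, a)))
      (hFs.comp (by fun_prop : Measurable fun p : Fin 3 × ℝ => (p, a))),
    lintegral_circleLeb (hm _), lintegral_circleLeb (hm _)]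
  simp only [S.lintegral_unitLeb_comp_skew hF, Fin.sum_univ_three]
  have h1 : (2 : Fin 3) + 1 = 0 := rfl
  have h2 : (0 : Fin 3) - 1 = 2 := rfl
  have h3 : (2 : Fin 3) - 1 = 1 := rfl
  have h4 : (1 : Fin 3) + 1 = 2 := rfl
  simp only [h1, h2, h3, h4, zero_add, sub_self]
  ring

lemma abs_integral_le_of_forall_sliceMean {L : Type*} [MeasurableSpace L] {ν : Measure L}
    [IsProbabilityMeasure ν] {F : (Fin 3 × ℝ) × L → ℝ} (hF : Measurable F) {B : ℝ}
    (hB : ∀ p, |F p| ≤ B) {e : ℝ} (he : ∀ i a, |sliceMean F i a| ≤ e) :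
    |∫ p, F p ∂(circleLeb.prod ν)| ≤ e := by
  have hint : Integrable F (circleLeb.prod ν) :=
    .of_bound hF.aestronglyMeasurable B (.of_forall hB)
  rw [integral_prod_symm _ hint]
  have := norm_integral_le_of_norm_le_const (μ := ν) (C := e)
    (f := fun a => ∫ p, F (p, a) ∂circleLeb) (.of_forall fun a => by
      rw [integral_circleLeb (F := fun p => F (p, a)) (.of_bound (hF.comp (by fun_prop : Measurable fun p : Fin 3 × ℝ => (p, a))).aestronglyMeasurable B
        (.of_forall fun _ => hB _)), Fin.sum_univ_three, Real.norm_eq_abs]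
      have h0 := abs_le.1 (he 0 a)
      have h1 := abs_le.1 (he 1 a)
      have h2 := abs_le.1 (he 2 a)
      simp only [sliceMean] at h0 h1 h2
      exact abs_le.2 ⟨by linarith, by linarith⟩)
  simpa using this

/-- Mixing for a continuous function with values in `[0, 1]`. -/
lemma IsStationary.exists_abs_correlation_le [CompactSpace K] (h : S.IsStationary ν)
    {φ : (Fin 3 × ℝ) × K → ℝ} (hφ : Continuous φ)
    (h01 : ∀ p, φ p ∈ Icc (0 : ℝ) 1) {ε : ℝ} (hε : 0 < ε) :
    ∃ N, |∫ p, φ p * φ (S.skew^[N] p) ∂(circleLeb.prod ν) - (∫ p, φ p ∂(circleLeb.prod ν)) ^ 2|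
      ≤ ε := by
  set m := circleLeb.prod ν with hm
  have hmeas := hφ.measurable
  have hmeas_n : ∀ n, Measurable fun p => φ (S.skew^[n] p) := fun n =>
    hmeas.comp (S.measurable_skew.iterate n)
  have habs : ∀ p, |φ p| ≤ 1 := fun p => abs_le.2 ⟨by linarith [(h01 p).1], (h01 p).2⟩
  have hint : ∀ n, Integrable (fun p => φ (S.skew^[n] p)) m := fun n =>
    .of_bound (hmeas_n n).aestronglyMeasurable 1 (.of_forall fun _ => habs _)
  have hpres : ∀ n, ∫ p, φ (S.skew^[n] p) ∂m = ∫ p, φ p ∂m := fun n =>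
by
    have hT := h.measurePreserving_skew.iterate n
    conv_rhs => rw [hm, ← hT.map_eq, integral_map hT.measurable.aemeasurable
      hφ.measurable.aestronglyMeasurable]
  have hmean_cont : ∀ i, Continuous (sliceMean φ i) := fun i =>
    continuous_of_dominated (bound := fun _ => 1)
      (fun a => (hmeas.comp (by fun_prop)).aestronglyMeasurable)
      (fun a => .of_forall fun x => habs _) (integrable_const _)
      (.of_forall fun x => hφ.comp (by fun_prop))
  obtain ⟨c, hc⟩ := S.exists_forall_markov_iterate_sub_le hmean_cont
  have hslice : ∀ n (c : ℝ) i a, sliceMean (fun p => φ (S.skew^[n] p) - c) i a =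
      S.markov^[n] (sliceMean φ) i a - c := by
    intro n c i a
    rw [← S.sliceMean_comp_skew_iterate hmeas habs n]
    simp only [sliceMean, Function.comp_apply]
    rw [integral_sub (integrable_slice (hmeas_n n) (fun _ => habs _) i a) (integrable_const _)]
    simp
  -- the limit of the slice means is the integral
  have hcint : c = ∫ p, φ p ∂m := by
    refine eq_of_forall_dist_le fun e he => ?_
    rw [Real.dist_eq]
    obtain ⟨N, hN⟩ := hc e he
    have := abs_integral_le_of_forall_sliceMean (ν := ν) (F := fun p => φ (S.skew^[N] p) - c)
      ((hmeas_n N).sub measurable_const) (B := 1 + |c|)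
      (fun p => (abs_sub _ _).trans (by gcongr; exact habs _)) (e := e)
      (fun i a => by rw [hslice]; exact hN N le_rfl i a)
    rw [integral_sub (hint N) (integrable_const _), hpres N] at this
    rw [abs_sub_comm]
    simpa using this
  have hc01 : |c| ≤ 1 := by
    rw [hcint]
    have := norm_integral_le_of_norm_le_const (μ := m) (C := 1) (f := φ) (.of_forall habs)
    simpa using this
  obtain ⟨n, hn⟩ := hc (ε / 3) (by linarith)
  -- a scale at which `φ` is nearly constant along each copy of the unit interval
  obtain ⟨t, ht, htφ⟩ : ∃ t > 0, ∀ i, ∀ x ∈ Ioo (0 : ℝ) 1, ∀ y ∈ Ioo (0 : ℝ) 1, ∀ a,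
      |x - y| ≤ t → |φ ((i, x), a) - φ ((i, y), a)| ≤ ε / 3 := by
    have : ∀ i, ∃ t > 0, ∀ x ∈ Ioo (0 : ℝ) 1, ∀ y ∈ Ioo (0 : ℝ) 1, ∀ a,
        |x - y| < t → |φ ((i, x), a) - φ ((i, y), a)| ≤ ε / 3 := by
      intro i
      have huc := ((isCompact_Icc (a := (0 : ℝ)) (b := 1)).prod
        (isCompact_univ (X := K))).uniformContinuousOn_of_continuous
        (f := fun q : ℝ × K => φ ((i, q.1), q.2)) (hφ.comp (by fun_prop)).continuousOn
      obtain ⟨t, ht, h⟩ := Metric.uniformContinuousOn_iff.1 huc (ε / 3) (by linarith)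
      refine ⟨t, ht, fun x hx y hy a hxy => (h (x, a) ⟨Ioo_subset_Icc_self hx, mem_univ _⟩ (y, a)
        ⟨Ioo_subset_Icc_self hy, mem_univ _⟩ ?_).le⟩
      rw [Prod.dist_eq]
      simpa [Real.dist_eq] using hxy
    choose t ht h using this
    obtain ⟨i₀, hi₀⟩ := Finite.exists_min t
    refine ⟨t i₀ / 2, by linarith [ht i₀], fun i x hx y hy a hxy => h i x hx y hy a ?_⟩
    linarith [ht i₀, hi₀ i]
  obtain ⟨k, hk⟩ : ∃ k, (1 - S.floor) ^ k ≤ t := by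
    rcases isEmpty_or_nonempty K with hK | ⟨⟨a⟩⟩
    · exact (NeZero.ne ν (Measure.eq_zero_of_isEmpty ν)).elim
    · have h1 := S.floor_le_weight a
      have h2 := S.floor_le_one_sub_weight a
      have h3 := S.floor_pos
      obtain ⟨k, hk⟩ := exists_pow_lt_of_lt_one ht (show 1 - S.floor < 1 by linarith)
      exact ⟨k, hk.le⟩
  refine ⟨n + k, ?_⟩
  have hdec := S.abs_integral_mul_comp_skew_iterate_le (H := fun p => φ (S.skew^[n] p) - c)
    ((hmeas_n n).sub measurable_const) (B := 2)
    (fun p => (abs_sub _ _).trans (by linarith [habs (S.skew^[n] p)])) (ε := ε / 3)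
    (fun i a => by rw [hslice]; exact hn n le_rfl i a) (ω := ε / 3) (by linarith) (M := 1) k
  have := abs_integral_le_of_forall_sliceMean (ν := ν)
    (F := fun p => φ p * (φ (S.skew^[n] (S.skew^[k] p)) - c))
    (hmeas.mul (((hmeas_n n).comp (S.measurable_skew.iterate k)).sub measurable_const)) (B := 2)
    (fun p => by
      rw [abs_mul]
      have h1 := abs_sub (φ (S.skew^[n] (S.skew^[k] p))) c
      have h2 := habs (S.skew^[n] (S.skew^[k] p))
      have h3 := habs p
      nlinarith [abs_nonneg (φ p), abs_nonneg (φ (S.skew^[n] (S.skew^[k] p)) - c)])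
    (e := ε) (fun i a => by
      have := hdec (fun x => φ ((i, x), a)) (hmeas.comp (by fun_prop)) (fun _ => habs _)
        (fun x hx y hy hxy => htφ i x hx y hy a (hxy.trans hk)) i a
      simp only [sliceMean]
      linarith)
  convert this using 2
  simp only [mul_sub]
  rw [integral_sub, integral_mul_const, sq, ← hcint]
  · simp only [Function.iterate_add_apply, hm]
  · refine .of_bound (hmeas.mul ((hmeas_n n).comp (S.measurable_skew.iterate k))).aestronglyMeasurable
      1 (.of_forall fun p => ?_)
    rw [norm_mul]
    exact mul_le_one₀ (habs _) (norm_nonneg _) (habs _)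
  · exact (hint 0).mul_const c

/-- Ergodicity of the skew product: approximating the indicator of an invariant set of measure `x`
by continuous functions, mixing gives `x = x ^ 2`. -/
lemma IsStationary.ergodic_skew [CompactSpace K] (h : S.IsStationary ν) :
    Ergodic S.skew (circleLeb.prod ν) := by
  refine ⟨h.measurePreserving_skew, ⟨fun {A} hA hinv => ?_⟩⟩
  set m := circleLeb.prod ν with hm
  set f : (Fin 3 × ℝ) × K → ℝ := A.indicator 1 with hf
  have hfm : Measurable f := measurable_one.indicator hA
  have hf01 : ∀ p, f p = 0 ∨ f p = 1 := fun p => by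
    by_cases hp : p ∈ A <;> simp [hf, hp]
  have hfint : Integrable f m := (integrable_const 1).indicator hA
  have hfT : ∀ n p, f (S.skew^[n] p) = f p := by
    intro n
    induction n with
    | zero => intro p; rfl
    | succ n ih =>
      intro p
      rw [Function.iterate_succ_apply, ih]
      have : S.skew p ∈ A ↔ p ∈ A := by rw [← mem_preimage, hinv]
      by_cases hp : p ∈ A <;> simp [hf, hp, this]
  have hmf : ∫ p, f p ∂m = m.real A := by rw [hf, integral_indicator_one hA]
  have hx1 : m.real A ≤ 1 := measureReal_le_one
  have hx0 : 0 ≤ m.real A := measureReal_nonneg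
  have hsq : m.real A = m.real A ^ 2 := by
    refine eq_of_forall_dist_le fun ε hε => ?_
    rw [Real.dist_eq]
    obtain ⟨g, hg, hgint⟩ := hfint.exists_boundedContinuous_integral_sub_le
      (show 0 < ε / 5 by linarith)
    set φ : (Fin 3 × ℝ) × K → ℝ := fun p => max 0 (min 1 (g p)) with hφ
    have hφc : Continuous φ := continuous_const.max (continuous_const.min g.continuous)
    have h01 : ∀ p, φ p ∈ Icc (0 : ℝ) 1 := fun p =>
      ⟨le_max_left _ _, max_le zero_le_one (min_le_left _ _)⟩
    have hφint : Integrable φ m := .of_bound hφc.measurable.aestronglyMeasurable 1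
      (.of_forall fun p => by rw [Real.norm_eq_abs, abs_of_nonneg (h01 p).1]; exact (h01 p).2)
    have hle : ∀ p, |f p - φ p| ≤ |f p - g p| := by
      intro p
      simp only [hφ]
      rcases hf01 p with h | h <;> rw [h] <;> rcases max_cases 0 (min 1 (g p)) with h' | h' <;>
        rcases min_cases 1 (g p) with h'' | h'' <;> rw [h'.1] <;> (try rw [h''.1]) <;>
        rcases abs_cases (0 - g p) with h3 | h3 <;> rcases abs_cases (1 - g p) with h4 | h4 <;>
        simp only [sub_zero, sub_self, abs_zero, abs_one, zero_sub, abs_neg] at * <;> linarith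
    have hclose : ∫ p, |f p - φ p| ∂m ≤ ε / 5 :=
      (integral_mono (hfint.sub hφint).abs (hfint.sub hgint).abs hle).trans hg
    obtain ⟨N, hN⟩ := h.exists_abs_correlation_le hφc h01 (show 0 < ε / 5 by linarith)
    have hT := h.measurePreserving_skew.iterate N
    have hclose' : ∫ p, |f p - φ (S.skew^[N] p)| ∂m ≤ ε / 5 := by
      refine le_trans (le_of_eq ?_) hclose
      conv_rhs => rw [hm, ← hT.map_eq, integral_map hT.measurable.aemeasurable
        (f := fun p => |f p - φ p|) (hfm.sub hφc.measurable).abs.aestronglyMeasurable]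
      simp only [hfT, hm]
    have hφT : Integrable (fun p => φ (S.skew^[N] p)) m := hT.integrable_comp_of_integrable hφint
    have hprod : Integrable (fun p => φ p * φ (S.skew^[N] p)) m := by
      refine .of_bound (hφc.measurable.mul
        (hφc.measurable.comp hT.measurable)).aestronglyMeasurable 1 (.of_forall fun p => ?_)
      have h1 := h01 p
      have h2 := h01 (S.skew^[N] p)
      rw [Real.norm_eq_abs, abs_of_nonneg (mul_nonneg h1.1 h2.1)]
      exact mul_le_one₀ h1.2 h2.1 h2.2
    have e1 : |m.real A - ∫ p, φ p * φ (S.skew^[N] p) ∂m| ≤ ε / 5 + ε / 5 := by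
      rw [← hmf, ← integral_sub hfint hprod]
      refine (abs_integral_le_integral_abs).trans ((integral_mono (hfint.sub hprod).abs
        ((hfint.sub hφint).abs.add (hfint.sub hφT).abs) fun p => ?_).trans ?_)
      · have h1 := h01 p
        have h2 := h01 (S.skew^[N] p)
        simp only [Pi.add_apply, Pi.sub_apply]
        have e : f p - φ p * φ (S.skew^[N] p) =
            f p * (f p - φ (S.skew^[N] p)) + φ (S.skew^[N] p) * (f p - φ p) := by
          rcases hf01 p with h | h <;> rw [h] <;> ring
        have hf1 : |f p| ≤ 1 := by rcases hf01 p with h | h <;> rw [h] <;> simp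
        have hφ1 : |φ (S.skew^[N] p)| ≤ 1 := by rw [abs_of_nonneg h2.1]; exact h2.2
        rw [e]
        refine (abs_add_le _ _).trans ?_
        rw [abs_mul, abs_mul, add_comm]
        exact add_le_add (mul_le_of_le_one_left (abs_nonneg _) hφ1)
          (mul_le_of_le_one_left (abs_nonneg _) hf1)
      · rw [integral_add' (hfint.sub hφint).abs (hfint.sub hφT).abs]
        exact add_le_add hclose hclose'
    have e2 : |m.real A - ∫ p, φ p ∂m| ≤ ε / 5 := by
      rw [← hmf, ← integral_sub hfint hφint]
      exact abs_integral_le_integral_abs.trans hclose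
    have i0 : 0 ≤ ∫ p, φ p ∂m := integral_nonneg fun p => (h01 p).1
    have i1 : ∫ p, φ p ∂m ≤ 1 := by
      have := integral_mono hφint (integrable_const 1) fun p => (h01 p).2
      simpa using this
    rw [abs_le] at *
    constructor <;> nlinarith
  have : m A = 0 ∨ m A = 1 := by
    have h2 : m.real A = 0 ∨ m.real A = 1 := by
      rcases eq_or_ne (m.real A) 0 with h | h
      · exact .inl h
      · exact .inr (mul_left_cancel₀ h (by linarith))
    rcases h2 with h | h
    · exact .inl ((measureReal_eq_zero_iff).1 h)
    · refine .inr ?_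
      rw [← ENNReal.ofReal_toReal (measure_ne_top m A)]
      simp only [Measure.real] at h
      rw [h, ENNReal.ofReal_one]
  rw [eventuallyConst_set']
  rcases this with h | h
  · exact .inl (ae_eq_empty.2 h)
  · exact .inr (ae_eq_univ.2 ((prob_compl_eq_zero_iff hA).2 h))

end PlaceIFS

/-! ### The collision map in coordinates -/

namespace Pinball

/-- The arc length parameter of the point at distance `x` from the start of side `i`. -/
noncomputable def arc (i : Fin 3) (x : ℝ) : ℝ := (i : ℕ) + x

/-- For `|θ| ≤ π / 6`, the length of the part of a side from which particles leaving at the angle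
`θ` hit the next side in counterclockwise order. For steeper angles the formula gives a number
outside `[0, 1]`, and comparisons with it still tell which side is hit. -/
noncomputable def hitWeight (θ : ℝ) : ℝ := (1 + √3 * Real.tan θ) / 2

/-- The centre of the triangle. -/
noncomputable def centre : ℂ := ⟨1 / 2, √3 / 6⟩

/-- The primitive third root of unity, which rotates each side of the triangle to the next one. -/
noncomputable def omega : ℂ := ⟨-1 / 2, √3 / 2⟩

/-- The conjugate root of unity, which rotates each side of the triangle to the previous one. -/
noncomputable def omegaBar : ℂ := ⟨-1 / 2, -(√3 / 2)⟩

lemma sqrt_three_mul_self : √3 * √3 = 3 := Real.mul_self_sqrt (by norm_num)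

lemma floor_arc (i : Fin 3) {x : ℝ} (hx : x ∈ Ico (0 : ℝ) 1) : ⌊arc i x⌋ = (i : ℕ) := by
  rw [Int.floor_eq_iff, arc]
  push_cast
  exact ⟨by linarith [hx.1], by linarith [hx.2]⟩

lemma natFloor_arc (i : Fin 3) {x : ℝ} (hx : x ∈ Ico (0 : ℝ) 1) : ⌊arc i x⌋₊ = (i : ℕ) := by
  rw [Nat.floor_eq_iff (by unfold arc; have := hx.1; positivity), arc]
  exact ⟨by linarith [hx.1], by linarith [hx.2]⟩

lemma fract_arc (i : Fin 3) {x : ℝ} (hx : x ∈ Ico (0 : ℝ) 1) : Int.fract (arc i x) = x := by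
  rw [Int.fract, floor_arc i hx, arc]
  push_cast
  ring

lemma mem_sides_iff {s : ℝ} : s ∈ sides ↔ ∃ i : Fin 3, ∃ x ∈ Ioo (0 : ℝ) 1, s = arc i x := by
  simp only [sides, mem_union, mem_Ioo, arc]
  constructor
  · rintro ((⟨h0, h1⟩ | ⟨h0, h1⟩) | ⟨h0, h1⟩)
    · exact ⟨0, s, ⟨h0, h1⟩, by simp⟩
    · exact ⟨1, s - 1, ⟨by linarith, by linarith⟩, by simp⟩
    · exact ⟨2, s - 2, ⟨by linarith, by linarith⟩, by simp⟩
  · rintro ⟨i, x, ⟨h0, h1⟩, rfl⟩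
    fin_cases i <;> simp <;> grind

lemma tangent_zero : tangent 0 = 1 := by simp [tangent]

lemma tangent_one : tangent 1 = omega := by
  have h : (2 * Real.pi * ((1 : ℤ) : ℝ) / 3 : ℝ) = Real.pi - Real.pi / 3 := by push_cast; ring
  rw [tangent, h, Complex.exp_mul_I, ← Complex.ofReal_cos, ← Complex.ofReal_sin, Real.cos_pi_sub,
    Real.sin_pi_sub, Real.cos_pi_div_three, Real.sin_pi_div_three]
  apply Complex.ext <;> simp [omega]
  norm_num

lemma tangent_two : tangent 2 = omegaBar := by
  have h : (2 * Real.pi * ((2 : ℤ) : ℝ) / 3 : ℝ) = Real.pi / 3 + Real.pi := by push_cast; ring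
  rw [tangent, h, Complex.exp_mul_I, ← Complex.ofReal_cos, ← Complex.ofReal_sin, Real.cos_add_pi,
    Real.sin_add_pi, Real.cos_pi_div_three, Real.sin_pi_div_three]
  apply Complex.ext <;> simp [omegaBar]
  norm_num

lemma omega_mul_omegaBar : omega * omegaBar = 1 := by
  have := sqrt_three_mul_self
  apply Complex.ext <;> simp [omega, omegaBar] <;> linarith

lemma omega_mul_omega : omega * omega = omegaBar := by
  have := sqrt_three_mul_self
  apply Complex.ext <;> simp [omega, omegaBar] <;> linarith

lemma omegaBar_mul_omegaBar : omegaBar * omegaBar = omega := by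
  have := sqrt_three_mul_self
  apply Complex.ext <;> simp [omega, omegaBar] <;> linarith

lemma tangent_ne_zero (i : ℤ) : tangent i ≠ 0 := Complex.exp_ne_zero _

lemma tangent_add_one (i : Fin 3) : tangent ((i + 1 : Fin 3) : ℕ) = tangent (i : ℕ) * omega := by
  fin_cases i
  · simpa [tangent_zero] using tangent_one
  · simpa [tangent_one, omega_mul_omega] using tangent_two
  · simpa [tangent_two, mul_comm omegaBar, omega_mul_omegaBar] using tangent_zero

lemma tangent_sub_one (i : Fin 3) : tangent ((i - 1 : Fin 3) : ℕ) = tangent (i : ℕ) * omegaBar := by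
  fin_cases i
  · simpa [tangent_zero] using tangent_two
  · simpa [tangent_one, omega_mul_omegaBar] using tangent_zero
  · simpa [tangent_two, omegaBar_mul_omegaBar] using tangent_one

/-- The point at distance `x` from the start of side `i`, in terms of the rotation by
`tangent i` about the centre of the triangle. -/
noncomputable def sidePoint (i : Fin 3) (x : ℝ) : ℂ := centre + tangent (i : ℕ) * (x - centre)

lemma boundary_arc (i : Fin 3) {x : ℝ} (hx : x ∈ Ico (0 : ℝ) 1) :
    boundary (arc i x) = sidePoint i x := by
  have h3 := sqrt_three_mul_self
  rw [boundary, floor_arc i hx, natFloor_arc i hx, fract_arc i hx, sidePoint]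
  fin_cases i
  · simp [tangent_zero]
  · simp only [Finset.range_one, Finset.sum_singleton, Nat.cast_zero, Nat.cast_one, tangent_zero, tangent_one]
    apply Complex.ext <;> simp [omega, centre] <;> linarith
  · simp only [Finset.sum_range_succ, Finset.sum_range_zero, Nat.cast_zero, Nat.cast_one, Nat.cast_ofNat, tangent_zero, tangent_one,
      tangent_two]
    apply Complex.ext <;> simp [omega, omegaBar, centre] <;> linarith

lemma mem_boundary_image {z : ℂ} (hz : z ∈ boundary '' Icc 0 3) :
    ∃ i : Fin 3, ∃ x ∈ Icc (0 : ℝ) 1, z = sidePoint i x := by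
  obtain ⟨s, ⟨h0, h3⟩, rfl⟩ := hz
  have key : ∀ i : Fin 3, ∀ x ∈ Ico (0 : ℝ) 1, s = arc i x →
      ∃ i : Fin 3, ∃ x ∈ Icc (0 : ℝ) 1, boundary s = sidePoint i x := by
    rintro i x hx rfl
    exact ⟨i, x, Ico_subset_Icc_self hx, boundary_arc i hx⟩
  rcases lt_or_ge s 1 with h | h
  · exact key 0 s ⟨h0, h⟩ (by simp [arc])
  rcases lt_or_ge s 2 with h' | h'
  · exact key 1 (s - 1) ⟨by linarith, by linarith⟩ (by simp [arc])
  rcases lt_or_ge s 3 with h'' | h''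
  · exact key 2 (s - 2) ⟨by linarith, by linarith⟩ (by simp [arc])
  -- the parameter `3` stands for the vertex `0`
  obtain rfl : s = 3 := le_antisymm h3 h''
  refine ⟨0, 0, by simp, ?_⟩
  have hf : ⌊(3 : ℝ)⌋ = 3 := by norm_num
  have hf' : ⌊(3 : ℝ)⌋₊ = 3 := by norm_num
  rw [boundary, hf, hf', Int.fract, hf, sidePoint]
  simp only [Finset.sum_range_succ, Finset.sum_range_zero, Nat.cast_zero, Nat.cast_one,
    Nat.cast_ofNat, tangent_zero, tangent_one, tangent_two, Fin.val_zero]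
  apply Complex.ext <;> simp [omega, omegaBar]
  norm_num

/-- The unit vector at the angle `θ` from the inward normal of side `0`. -/
noncomputable def ray (θ : ℝ) : ℂ := ⟨Real.sin θ, Real.cos θ⟩

lemma direction_arc (i : Fin 3) {x : ℝ} (hx : x ∈ Ico (0 : ℝ) 1) (θ : ℝ) :
    direction (arc i x) θ = tangent (i : ℕ) * ray θ := by
  rw [direction, floor_arc i hx, normal, show ray θ = (Real.sin θ : ℂ) + Real.cos θ * Complex.I by
    apply Complex.ext <;> simp [ray] <;> rfl]
  ring

lemma fin_three_cases (i j : Fin 3) : j = i ∨ j = i + 1 ∨ j = i - 1 := by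
  revert i j; decide

lemma hitWeight_mul_cos {θ : ℝ} (hc : 0 < Real.cos θ) :
    hitWeight θ * Real.cos θ = (Real.cos θ + √3 * Real.sin θ) / 2 := by
  rw [hitWeight, div_mul_eq_mul_div, add_mul, mul_assoc, Real.tan_mul_cos hc.ne', one_mul]

lemma hit_self_iff {i : Fin 3} {x y t θ : ℝ} :
    sidePoint i y = sidePoint i x + t * (tangent (i : ℕ) * ray θ) ↔
      y = x + t * Real.sin θ ∧ 0 = t * Real.cos θ := by
  have : sidePoint i y = sidePoint i x + t * (tangent (i : ℕ) * ray θ) ↔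
      (y : ℂ) = x + t * ray θ := by
    rw [← mul_right_inj' (tangent_ne_zero (i : ℕ)) (b := (y : ℂ)), sidePoint, sidePoint]
    constructor <;> intro h <;> linear_combination h
  rw [this, Complex.ext_iff]
  simp [ray]

/-- When and where the trajectory starting on side `i` meets the line through side `i + 1`. -/
lemma hit_add_one_iff {i : Fin 3} {x y t θ : ℝ} (hc : 0 < Real.cos θ) :
    sidePoint (i + 1) y = sidePoint i x + t * (tangent (i : ℕ) * ray θ) ↔
      1 - x = y * hitWeight θ ∧ √3 / 2 * y = t * Real.cos θ := by
  have h3 := sqrt_three_mul_self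
  have : sidePoint (i + 1) y = sidePoint i x + t * (tangent (i : ℕ) * ray θ) ↔
      omega * (y - centre) = x - centre + t * ray θ := by
    rw [← mul_right_inj' (tangent_ne_zero (i : ℕ)) (b := omega * (y - centre)),
      sidePoint, sidePoint, tangent_add_one]
    constructor <;> intro h <;> linear_combination h
  rw [this, Complex.ext_iff]
  have hw := hitWeight_mul_cos hc
  simp only [omega, centre, ray, Complex.mul_re, Complex.mul_im, Complex.sub_re, Complex.sub_im,
    Complex.add_re, Complex.add_im, Complex.ofReal_re, Complex.ofReal_im]
  constructor
  · rintro ⟨h1, h2⟩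
    have e : √3 / 2 * y = t * Real.cos θ := by linarith
    refine ⟨?_, e⟩
    apply mul_right_cancel₀ hc.ne'
    rw [mul_assoc, hw]
    linear_combination Real.cos θ * h1 - Real.sin θ * e - (Real.cos θ / 12) * h3
  · rintro ⟨h1, h2⟩
    refine ⟨?_, by linarith⟩
    apply mul_right_cancel₀ hc.ne'
    linear_combination Real.cos θ * h1 + y * hw + Real.sin θ * h2 + (Real.cos θ / 12) * h3

/-- When and where the trajectory starting on side `i` meets the line through side `i - 1`. -/
lemma hit_sub_one_iff {i : Fin 3} {x y t θ : ℝ} (hc : 0 < Real.cos θ) :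
    sidePoint (i - 1) y = sidePoint i x + t * (tangent (i : ℕ) * ray θ) ↔
      x = (1 - y) * (1 - hitWeight θ) ∧ √3 / 2 * (1 - y) = t * Real.cos θ := by
  have h3 := sqrt_three_mul_self
  have : sidePoint (i - 1) y = sidePoint i x + t * (tangent (i : ℕ) * ray θ) ↔
      omegaBar * (y - centre) = x - centre + t * ray θ := by
    rw [← mul_right_inj' (tangent_ne_zero (i : ℕ)) (b := omegaBar * (y - centre)),
      sidePoint, sidePoint, tangent_sub_one]
    constructor <;> intro h <;> linear_combination h
  rw [this, Complex.ext_iff]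
  have hw := hitWeight_mul_cos hc
  simp only [omegaBar, centre, ray, Complex.mul_re, Complex.mul_im, Complex.sub_re, Complex.sub_im,
    Complex.add_re, Complex.add_im, Complex.ofReal_re, Complex.ofReal_im]
  constructor
  · rintro ⟨h1, h2⟩
    have e : √3 / 2 * (1 - y) = t * Real.cos θ := by linarith
    refine ⟨?_, e⟩
    apply mul_right_cancel₀ hc.ne'
    linear_combination (-Real.cos θ) * h1 + (1 - y) * hw + Real.sin θ * e - (Real.cos θ / 12) * h3
  · rintro ⟨h1, h2⟩
    refine ⟨?_, by linarith⟩
    apply mul_right_cancel₀ hc.ne'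
    linear_combination (-Real.cos θ) * h1 + (1 - y) * hw + Real.sin θ * h2 - (Real.cos θ / 12) * h3

lemma ray_injOn {θ θ' : ℝ} (h : ray θ = ray θ') (hlt : |θ - θ'| < 2 * Real.pi) : θ = θ' := by
  have h1 : Real.sin θ = Real.sin θ' := (Complex.ext_iff.1 h).1
  have h2 : Real.cos θ = Real.cos θ' := (Complex.ext_iff.1 h).2
  have h3 : Real.cos (θ - θ') = 1 := by
    rw [Real.cos_sub, h1, h2]
    nlinarith [Real.sin_sq_add_cos_sq θ']
  rw [abs_lt] at hlt
  exact sub_eq_zero.1 ((Real.cos_eq_one_iff_of_lt_of_lt (by linarith) hlt.2).1 h3)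

lemma neg_omega_mul_ray (η : ℝ) : -(omega * ray η) = ray (η + Real.pi / 3) := by
  apply Complex.ext <;> simp [omega, ray, Real.sin_add, Real.cos_add] <;> ring

lemma neg_omegaBar_mul_ray (η : ℝ) : -(omegaBar * ray η) = ray (η - Real.pi / 3) := by
  apply Complex.ext <;> simp [omegaBar, ray, Real.sin_sub, Real.cos_sub] <;> ring

end Pinball

namespace Pinball

lemma hitWeight_mul_cos_eq_sin {θ : ℝ} (hc : 0 < Real.cos θ) :
    hitWeight θ * Real.cos θ = Real.sin (θ + Real.pi / 6) := by
  rw [hitWeight_mul_cos hc, Real.sin_add, Real.cos_pi_div_six, Real.sin_pi_div_six]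
  ring

lemma one_sub_hitWeight_mul_cos_eq_sin {θ : ℝ} (hc : 0 < Real.cos θ) :
    (1 - hitWeight θ) * Real.cos θ = Real.sin (Real.pi / 6 - θ) := by
  rw [sub_mul, hitWeight_mul_cos hc, Real.sin_sub, Real.cos_pi_div_six, Real.sin_pi_div_six]
  ring

lemma hitWeight_pos_iff {θ : ℝ} (hθ : θ ∈ Ioo (-(Real.pi / 2)) (Real.pi / 2)) :
    0 < hitWeight θ ↔ -(Real.pi / 6) < θ := by
  have hc := Real.cos_pos_of_mem_Ioo hθ
  rw [← mul_pos_iff_of_pos_right hc, hitWeight_mul_cos_eq_sin hc]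
  constructor
  · intro h
    by_contra hle
    exact h.not_ge (Real.sin_nonpos_of_nonpos_of_neg_pi_le (by linarith) (by linarith [hθ.1, hθ.2]))
  · intro h
    exact Real.sin_pos_of_pos_of_lt_pi (by linarith) (by linarith [hθ.1, hθ.2])

lemma one_sub_hitWeight_pos_iff {θ : ℝ} (hθ : θ ∈ Ioo (-(Real.pi / 2)) (Real.pi / 2)) :
    0 < 1 - hitWeight θ ↔ θ < Real.pi / 6 := by
  have hc := Real.cos_pos_of_mem_Ioo hθ
  rw [← mul_pos_iff_of_pos_right hc, one_sub_hitWeight_mul_cos_eq_sin hc]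
  constructor
  · intro h
    by_contra hle
    exact h.not_ge (Real.sin_nonpos_of_nonpos_of_neg_pi_le (by linarith) (by linarith [hθ.1, hθ.2]))
  · intro h
    exact Real.sin_pos_of_pos_of_lt_pi (by linarith) (by linarith [hθ.1, hθ.2])

lemma arc_mem_sides (i : Fin 3) {x : ℝ} (hx : x ∈ Ioo (0 : ℝ) 1) : arc i x ∈ sides :=
  mem_sides_iff.2 ⟨i, x, hx, rfl⟩

lemma sides_subset_Icc : sides ⊆ Icc 0 3 := by
  rintro s ((⟨h0, h1⟩ | ⟨h0, h1⟩) | ⟨h0, h1⟩) <;> constructor <;> linarith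

lemma div_mem_Ioo {x w : ℝ} (hx : 0 < x) (hxw : x < w) : x / w ∈ Ioo (0 : ℝ) 1 :=
  ⟨div_pos hx (hx.trans hxw), (div_lt_one (hx.trans hxw)).2 hxw⟩

lemma one_sub_mem_Ioo {x : ℝ} (hx : x ∈ Ioo (0 : ℝ) 1) : 1 - x ∈ Ioo (0 : ℝ) 1 :=
  ⟨by linarith [hx.2], by linarith [hx.1]⟩

variable {lam : ℝ}

/-- A particle starting closer than `hitWeight θ` to the end of side `i` hits side `i + 1`. On
its way it can meet no other side first: by `hit_sub_one_iff` it would have to start at a distance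
less than `1 - hitWeight θ` from the start of side `i`. -/
lemma step_add_one {i : Fin 3} {x θ : ℝ} (hx : x ∈ Ioo (0 : ℝ) 1)
    (hθ : θ ∈ Ioo (-(Real.pi / 2)) (Real.pi / 2)) (hxw : 1 - x < hitWeight θ) :
    Step lam (arc i x, θ) (arc (i + 1) ((1 - x) / hitWeight θ), -lam * (θ - Real.pi / 3)) := by
  have hc := Real.cos_pos_of_mem_Ioo hθ
  have hw : 0 < hitWeight θ := (sub_pos.2 hx.2).trans hxw
  have hy := div_mem_Ioo (sub_pos.2 hx.2) hxw
  set y := (1 - x) / hitWeight θ with hydef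
  have hyw : 1 - x = y * hitWeight θ := by rw [hydef]; field_simp
  have h3 : 0 < √3 := by positivity
  set t := √3 / 2 * y / Real.cos θ with htdef
  have ht : √3 / 2 * y = t * Real.cos θ := by rw [htdef]; field_simp
  have ht0 : 0 < t := div_pos (mul_pos (by positivity) hy.1) hc
  have hlow := (hitWeight_pos_iff hθ).1 hw
  have hit := (hit_add_one_iff (i := i) hc).2 ⟨hyw, ht⟩
  have hxi := Ioo_subset_Ico_self hx
  have hyi := Ioo_subset_Ico_self hy
  refine ⟨arc_mem_sides _ hx, hθ, arc_mem_sides _ hy, ⟨t, ⟨⟨ht0, ?_⟩, ?_⟩, ?_⟩,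
    θ - Real.pi / 3, ⟨by linarith, by linarith [hθ.2, Real.pi_pos]⟩, ?_, rfl⟩
  · rw [boundary_arc i hxi, direction_arc i hxi, ← hit]
    exact ⟨arc (i + 1) y, sides_subset_Icc (arc_mem_sides _ hy), boundary_arc _ hyi⟩
  · rintro t' ⟨ht'0, ht'⟩
    by_contra hlt
    push Not at hlt
    have hlt' := mul_lt_mul_of_pos_right hlt hc
    obtain ⟨k, x', hx', hk⟩ := mem_boundary_image ht'
    rw [boundary_arc i hxi, direction_arc i hxi] at hk
    rcases fin_three_cases i k with rfl | rfl | rfl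
    · exact (mul_pos ht'0 hc).ne ((hit_self_iff.1 hk.symm).2)
    · obtain ⟨-, e2⟩ := (hit_add_one_iff hc).1 hk.symm
      obtain ⟨e1, -⟩ := (hit_add_one_iff hc).1 hk.symm
      have : x' = y := mul_right_cancel₀ hw.ne' (e1.symm.trans hyw)
      subst this
      linarith
    · obtain ⟨e1, e2⟩ := (hit_sub_one_iff hc).1 hk.symm
      have hxy : 1 - x' < y := by
        refine lt_of_mul_lt_mul_left (a := √3 / 2) ?_ (by positivity)
        linarith
      have hw' : 0 < 1 - hitWeight θ := by
        refine pos_of_mul_pos_right (b := 1 - hitWeight θ) (e1 ▸ hx.1) (sub_nonneg.2 hx'.2)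
      have := mul_lt_mul_of_pos_right hxy hw'
      linarith [hy.2]
  · rw [boundary_arc i hxi, direction_arc i hxi, boundary_arc _ hyi, hit]
  · have := neg_omega_mul_ray (θ - Real.pi / 3)
    rw [sub_add_cancel] at this
    rw [direction_arc i hxi, direction_arc _ hyi, tangent_add_one, ← this]
    ring

/-- A particle starting closer than `1 - hitWeight θ` to the start of side `i` hits side
`i - 1`; this is the mirror image of `step_add_one`. -/
lemma step_sub_one {i : Fin 3} {x θ : ℝ} (hx : x ∈ Ioo (0 : ℝ) 1)
    (hθ : θ ∈ Ioo (-(Real.pi / 2)) (Real.pi / 2)) (hxw : x < 1 - hitWeight θ) :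
    Step lam (arc i x, θ) (arc (i - 1) (1 - x / (1 - hitWeight θ)), -lam * (θ + Real.pi / 3)) := by
  have hc := Real.cos_pos_of_mem_Ioo hθ
  have hw : 0 < 1 - hitWeight θ := hx.1.trans hxw
  have hy := one_sub_mem_Ioo (div_mem_Ioo hx.1 hxw)
  set y := 1 - x / (1 - hitWeight θ) with hydef
  have hyw : x = (1 - y) * (1 - hitWeight θ) := by rw [hydef]; field_simp; ring
  have h3 : 0 < √3 := by positivity
  set t := √3 / 2 * (1 - y) / Real.cos θ with htdef
  have ht : √3 / 2 * (1 - y) = t * Real.cos θ := by rw [htdef]; field_simp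
  have ht0 : 0 < t := div_pos (mul_pos (by positivity) (sub_pos.2 hy.2)) hc
  have hlow := (one_sub_hitWeight_pos_iff hθ).1 hw
  have hit := (hit_sub_one_iff (i := i) hc).2 ⟨hyw, ht⟩
  have hxi := Ioo_subset_Ico_self hx
  have hyi := Ioo_subset_Ico_self hy
  refine ⟨arc_mem_sides _ hx, hθ, arc_mem_sides _ hy, ⟨t, ⟨⟨ht0, ?_⟩, ?_⟩, ?_⟩,
    θ + Real.pi / 3, ⟨by linarith [hθ.1, Real.pi_pos], by linarith⟩, ?_, rfl⟩
  · rw [boundary_arc i hxi, direction_arc i hxi, ← hit]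
    exact ⟨arc (i - 1) y, sides_subset_Icc (arc_mem_sides _ hy), boundary_arc _ hyi⟩
  · rintro t' ⟨ht'0, ht'⟩
    by_contra hlt
    push Not at hlt
    have hlt' := mul_lt_mul_of_pos_right hlt hc
    obtain ⟨k, x', hx', hk⟩ := mem_boundary_image ht'
    rw [boundary_arc i hxi, direction_arc i hxi] at hk
    rcases fin_three_cases i k with rfl | rfl | rfl
    · exact (mul_pos ht'0 hc).ne ((hit_self_iff.1 hk.symm).2)
    · obtain ⟨e1, e2⟩ := (hit_add_one_iff hc).1 hk.symm
      have hxy : x' < 1 - y := by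
        refine lt_of_mul_lt_mul_left (a := √3 / 2) ?_ (by positivity)
        linarith
      have hw' : 0 < hitWeight θ := by
        refine pos_of_mul_pos_right (b := hitWeight θ) (e1 ▸ sub_pos.2 hx.2) hx'.1
      have := mul_lt_mul_of_pos_right hxy hw'
      linarith [hy.1]
    · obtain ⟨e1, e2⟩ := (hit_sub_one_iff hc).1 hk.symm
      have : 1 - x' = 1 - y := mul_right_cancel₀ hw.ne' (e1.symm.trans hyw)
      rw [this] at e2
      linarith
  · rw [boundary_arc i hxi, direction_arc i hxi, boundary_arc _ hyi, hit]
  · have := neg_omegaBar_mul_ray (θ + Real.pi / 3)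
    rw [add_sub_cancel_right] at this
    rw [direction_arc i hxi, direction_arc _ hyi, tangent_sub_one, ← this]
    ring

/-- The two formulas for the collision are the only possibilities; in particular there is no
collision if `x = 1 - hitWeight θ`, when the trajectory runs into a vertex. -/
lemma step_cases {i : Fin 3} {x θ : ℝ} (hx : x ∈ Ioo (0 : ℝ) 1) {q : ℝ × ℝ}
    (h : Step lam (arc i x, θ) q) :
    (1 - x < hitWeight θ ∧
      q = (arc (i + 1) ((1 - x) / hitWeight θ), -lam * (θ - Real.pi / 3))) ∨
    (x < 1 - hitWeight θ ∧
      q = (arc (i - 1) (1 - x / (1 - hitWeight θ)), -lam * (θ + Real.pi / 3))) := by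
  obtain ⟨-, hθ, hq, ⟨t, ⟨⟨ht0, -⟩, -⟩, hb⟩, η, hη, hdir, hq2⟩ := h
  obtain ⟨s', θ'⟩ := q
  obtain ⟨j, y, hy, rfl⟩ := mem_sides_iff.1 hq
  simp only at hθ hb hdir hq2
  have hc := Real.cos_pos_of_mem_Ioo hθ
  have hxi := Ioo_subset_Ico_self hx
  have hyi := Ioo_subset_Ico_self hy
  rw [boundary_arc _ hxi, boundary_arc _ hyi, direction_arc _ hxi] at hb
  rw [direction_arc _ hxi, direction_arc _ hyi] at hdir
  rcases fin_three_cases i j with rfl | rfl | rfl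
  · exact ((mul_pos ht0 hc).ne (hit_self_iff.1 hb).2).elim
  · left
    obtain ⟨e1, -⟩ := (hit_add_one_iff hc).1 hb
    have hw : 0 < hitWeight θ :=
      pos_of_mul_pos_right (b := hitWeight θ) (e1 ▸ sub_pos.2 hx.2) hy.1.le
    have hη' : η = θ - Real.pi / 3 := by
      have : ray θ = ray (η + Real.pi / 3) := by
        rw [← neg_omega_mul_ray]
        apply mul_left_cancel₀ (tangent_ne_zero (i : ℕ))
        rw [hdir, tangent_add_one]
        ring
      have := ray_injOn this (abs_lt.2 ⟨by linarith [hθ.1, hη.2, Real.pi_pos],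
        by linarith [hθ.2, hη.1, Real.pi_pos]⟩)
      linarith
    refine ⟨by rw [e1]; exact mul_lt_of_lt_one_left hw hy.2, ?_⟩
    rw [hq2, hη', e1, mul_div_cancel_right₀ _ hw.ne']
  · right
    obtain ⟨e1, -⟩ := (hit_sub_one_iff hc).1 hb
    have hw : 0 < 1 - hitWeight θ :=
      pos_of_mul_pos_right (b := 1 - hitWeight θ) (e1 ▸ hx.1) (sub_pos.2 hy.2).le
    have hη' : η = θ + Real.pi / 3 := by
      have : ray θ = ray (η - Real.pi / 3) := by
        rw [← neg_omegaBar_mul_ray]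
        apply mul_left_cancel₀ (tangent_ne_zero (i : ℕ))
        rw [hdir, tangent_sub_one]
        ring
      have := ray_injOn this (abs_lt.2 ⟨by linarith [hθ.1, hη.2, Real.pi_pos],
        by linarith [hθ.2, hη.1, Real.pi_pos]⟩)
      linarith
    refine ⟨?_, ?_⟩
    · conv_lhs => rw [e1]
      exact mul_lt_of_lt_one_left hw (by linarith [hy.1])
    · have : x / (1 - hitWeight θ) = 1 - y := by rw [e1, mul_div_cancel_right₀ _ hw.ne']
      rw [hq2, hη', this, sub_sub_cancel]

lemma step_T {p : ℝ × ℝ} (hp : p ∈ domain lam) : Step lam p (T lam p) := by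
  have h : ∃ q, Step lam p q := hp
  rw [T, dif_pos h]
  exact h.choose_spec

lemma T_of_notMem {p : ℝ × ℝ} (hp : p ∉ domain lam) : T lam p = p := by
  have h : ¬ ∃ q, Step lam p q := hp
  rw [T, dif_neg h]

lemma T_add_one {i : Fin 3} {x θ : ℝ} (hx : x ∈ Ioo (0 : ℝ) 1)
    (hθ : θ ∈ Ioo (-(Real.pi / 2)) (Real.pi / 2)) (hxw : 1 - x < hitWeight θ) :
    T lam (arc i x, θ) = (arc (i + 1) ((1 - x) / hitWeight θ), -lam * (θ - Real.pi / 3)) := by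
  rcases step_cases hx (step_T ⟨_, step_add_one (lam := lam) (i := i) hx hθ hxw⟩) with h | h
  · exact h.2
  · linarith [h.1]

lemma T_sub_one {i : Fin 3} {x θ : ℝ} (hx : x ∈ Ioo (0 : ℝ) 1)
    (hθ : θ ∈ Ioo (-(Real.pi / 2)) (Real.pi / 2)) (hxw : x < 1 - hitWeight θ) :
    T lam (arc i x, θ) =
      (arc (i - 1) (1 - x / (1 - hitWeight θ)), -lam * (θ + Real.pi / 3)) := by
  rcases step_cases hx (step_T ⟨_, step_sub_one (lam := lam) (i := i) hx hθ hxw⟩) with h | h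
  · linarith [h.1]
  · exact h.2

lemma mem_domain_iff {p : ℝ × ℝ} : p ∈ domain lam ↔ p.1 ∈ sides ∧
    p.2 ∈ Ioo (-(Real.pi / 2)) (Real.pi / 2) ∧ Int.fract p.1 ≠ 1 - hitWeight p.2 := by
  obtain ⟨s, θ⟩ := p
  constructor
  · rintro ⟨q, hq⟩
    refine ⟨hq.1, hq.2.1, ?_⟩
    obtain ⟨i, x, hx, rfl⟩ := mem_sides_iff.1 hq.1
    simp only [fract_arc i (Ioo_subset_Ico_self hx)]
    rcases step_cases hx hq with h | h
    · exact fun e => by linarith [h.1]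
    · exact h.1.ne
  · rintro ⟨hs, hθ, hne⟩
    obtain ⟨i, x, hx, rfl⟩ := mem_sides_iff.1 hs
    simp only [fract_arc i (Ioo_subset_Ico_self hx)] at hne
    rcases lt_or_gt_of_ne hne with h | h
    · exact ⟨_, step_sub_one hx hθ h⟩
    · exact ⟨_, step_add_one hx hθ (by linarith)⟩

lemma snd_T {p : ℝ × ℝ} (hp : p ∈ domain lam) :
    (T lam p).2 = -lam * (p.2 - Real.pi / 3) ∨ (T lam p).2 = -lam * (p.2 + Real.pi / 3) := by
  have h := step_T hp
  obtain ⟨s, θ⟩ := p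
  obtain ⟨i, x, hx, rfl⟩ := mem_sides_iff.1 h.1
  rcases step_cases hx h with h | h
  · left; rw [h.2]
  · right; rw [h.2]

lemma fst_T_mem_sides {p : ℝ × ℝ} (hp : p ∈ domain lam) : (T lam p).1 ∈ sides := (step_T hp).2.2.1

lemma measurableSet_sides : MeasurableSet sides :=
  (measurableSet_Ioo.union measurableSet_Ioo).union measurableSet_Ioo

lemma measurable_hitWeight : Measurable hitWeight := by
  have : Measurable Real.tan := by
    have : Real.tan = fun x => Real.sin x / Real.cos x := funext Real.tan_eq_sin_div_cos
    rw [this]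
    fun_prop
  unfold hitWeight
  fun_prop

lemma measurableSet_domain : MeasurableSet (domain lam) := by
  have h : domain lam = {p | p.1 ∈ sides} ∩ ({p | p.2 ∈ Ioo (-(Real.pi / 2)) (Real.pi / 2)} ∩
      {p | Int.fract p.1 = 1 - hitWeight p.2}ᶜ) := by
    ext p
    exact mem_domain_iff
  have hw := measurable_hitWeight
  rw [h]
  refine (measurable_fst measurableSet_sides).inter ((measurable_snd measurableSet_Ioo).inter
    (MeasurableSet.compl ?_))
  exact measurableSet_eq_fun (measurable_fract.comp measurable_fst) (by fun_prop)

lemma measurable_arc {α : Type*} [MeasurableSpace α] {f : α → Fin 3} {g : α → ℝ}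
    (hf : Measurable f) (hg : Measurable g) : Measurable fun a => arc (f a) (g a) := by
  have : Measurable fun i : Fin 3 => ((i : ℕ) : ℝ) := measurable_from_top
  exact (this.comp hf).add hg

lemma measurable_T : Measurable (T lam) := by
  classical
  -- the side of a boundary point, a junk side outside `[0, 3)`
  let side : ℝ → Fin 3 := fun s => Fin.ofNat 3 ⌊s⌋₊
  have hside : Measurable side :=
    (measurable_from_top : Measurable (Fin.ofNat 3)).comp Nat.measurable_floor
  have hside_arc : ∀ (i : Fin 3) (x : ℝ), x ∈ Ioo (0 : ℝ) 1 → side (arc i x) = i := by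
    intro i x hx
    simp only [side, natFloor_arc i (Ioo_subset_Ico_self hx)]
    exact Fin.ofNat_val_eq_self i
  have hw := measurable_hitWeight
  have hfr : Measurable fun p : ℝ × ℝ => Int.fract p.1 := measurable_fract.comp measurable_fst
  have hT : T lam = fun p : ℝ × ℝ => if p ∈ domain lam then
      if 1 - Int.fract p.1 < hitWeight p.2 then
        (arc (side p.1 + 1) ((1 - Int.fract p.1) / hitWeight p.2), -lam * (p.2 - Real.pi / 3))
      else (arc (side p.1 - 1) (1 - Int.fract p.1 / (1 - hitWeight p.2)),
        -lam * (p.2 + Real.pi / 3)) else p := by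
    ext1 p
    by_cases hp : p ∈ domain lam
    · obtain ⟨hs, hθ, hne⟩ := mem_domain_iff.1 hp
      obtain ⟨s, θ⟩ := p
      obtain ⟨i, x, hx, rfl⟩ := mem_sides_iff.1 hs
      simp only [if_pos hp, fract_arc i (Ioo_subset_Ico_self hx), hside_arc i x hx] at hne ⊢
      split_ifs with h
      · exact T_add_one hx hθ h
      · exact T_sub_one hx hθ (lt_of_le_of_ne (by linarith) hne)
    · rw [if_neg hp, T_of_notMem hp]
  have hadd : Measurable fun i : Fin 3 => i + 1 := measurable_from_top
  have hsub : Measurable fun i : Fin 3 => i - 1 := measurable_from_top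
  rw [hT]
  refine Measurable.ite measurableSet_domain (Measurable.ite (measurableSet_lt (by fun_prop)
    (by fun_prop)) ?_ ?_) measurable_id
  · exact (measurable_arc (hadd.comp (hside.comp measurable_fst)) (by fun_prop)).prodMk
      (by fun_prop)
  · exact (measurable_arc (hsub.comp (hside.comp measurable_fst)) (by fun_prop)).prodMk
      (by fun_prop)

lemma measurableSet_Sing : MeasurableSet (Sing lam) := by
  have : Sing lam = fullSpace ∩ ⋃ n : ℕ, (T lam)^[n] ⁻¹' (domain lam)ᶜ := by
    ext p; simp [Sing]
  rw [this]
  exact (measurableSet_Icc.prod measurableSet_Ioo).inter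
    (.iUnion fun n => measurable_T.iterate n measurableSet_domain.compl)

end Pinball

/-! ### The Cantor set of limit angles -/

namespace Pinball

/-- The sign `1` or `-1` that a Boolean stands for. -/
def signOf (b : Bool) : ℝ := if b then 1 else -1

lemma signOf_not (b : Bool) : signOf (!b) = -signOf b := by cases b <;> simp [signOf]

lemma abs_signOf (b : Bool) : |signOf b| = 1 := by cases b <;> simp [signOf]

lemma signOf_eq_or (b : Bool) : signOf b = 1 ∨ signOf b = -1 := by cases b <;> simp [signOf]

/-- The point of `C lam` with a given sequence of signs. The index is shifted by one, as in `C`. -/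
noncomputable def code (lam : ℝ) (b : ℕ → Bool) : ℝ :=
  ∑' n : ℕ, Real.pi / 3 * (signOf (b n) * lam ^ (n + 1))

variable {lam : ℝ}

lemma norm_code_term_le (hlam0 : 0 < lam) (b : Bool) (n : ℕ) :
    ‖Real.pi / 3 * (signOf b * lam ^ (n + 1))‖ ≤ Real.pi / 3 * lam ^ (n + 1) := by
  rw [norm_mul, norm_mul, Real.norm_eq_abs (signOf b), abs_signOf, one_mul, norm_pow,
    Real.norm_of_nonneg hlam0.le, Real.norm_of_nonneg (by positivity)]

lemma hasSum_bound (hlam0 : 0 < lam) (hlam1 : lam < 1 / 3) :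
    HasSum (fun n : ℕ => Real.pi / 3 * lam ^ (n + 1)) (Real.pi / 3 * (lam * (1 - lam)⁻¹)) := by
  refine HasSum.mul_left _ ?_
  simp only [pow_succ']
  exact (hasSum_geometric_of_lt_one hlam0.le (by linarith)).mul_left lam

lemma hasSum_code (hlam0 : 0 < lam) (hlam1 : lam < 1 / 3) (b : ℕ → Bool) :
    HasSum (fun n : ℕ => Real.pi / 3 * (signOf (b n) * lam ^ (n + 1))) (code lam b) :=
  (Summable.of_norm_bounded (hasSum_bound hlam0 hlam1).summable
    fun n => norm_code_term_le hlam0 (b n) n).hasSum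

lemma C_eq_range (hlam0 : 0 < lam) (hlam1 : lam < 1 / 3) : C lam = range (code lam) := by
  ext x
  constructor
  · rintro ⟨z, hz, hsum⟩
    refine ⟨fun n => decide (z n = 1), ?_⟩
    refine (hasSum_code hlam0 hlam1 _).unique ?_
    convert hsum using 4 with n
    rcases hz n with h | h
    · simp [signOf, h]
    · simp only [signOf, h]
      norm_num
  · rintro ⟨b, rfl⟩
    exact ⟨fun n => signOf (b n), fun n => signOf_eq_or (b n), hasSum_code hlam0 hlam1 b⟩

lemma code_eq (hlam0 : 0 < lam) (hlam1 : lam < 1 / 3) (b : ℕ → Bool) :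
    code lam b = lam * (Real.pi / 3 * signOf (b 0)) + lam * code lam fun n => b (n + 1) := by
  rw [code, (hasSum_code hlam0 hlam1 b).summable.tsum_eq_zero_add, code, ← tsum_mul_left]
  congr 1
  · ring
  · congr 1
    ext n
    ring

lemma code_not (b : ℕ → Bool) : code lam (fun n => !(b n)) = -code lam b := by
  rw [code, code, ← tsum_neg]
  congr 1
  ext n
  rw [signOf_not]
  ring

lemma abs_code_lt (hlam0 : 0 < lam) (hlam1 : lam < 1 / 3) (b : ℕ → Bool) :
    |code lam b| < Real.pi / 6 := by
  have h := tsum_of_norm_bounded (hasSum_bound hlam0 hlam1) fun n => norm_code_term_le hlam0 (b n) n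
  have h1 : lam * (1 - lam)⁻¹ < 1 / 2 := by
    rw [← div_eq_mul_inv, div_lt_iff₀ (by linarith)]
    linarith
  have := mul_lt_mul_of_pos_left h1 (show 0 < Real.pi / 3 by positivity)
  rw [Real.norm_eq_abs] at h
  exact h.trans_lt (by linarith)

lemma C_subset (hlam0 : 0 < lam) (hlam1 : lam < 1 / 3) :
    C lam ⊆ Ioo (-(Real.pi / 6)) (Real.pi / 6) := by
  rw [C_eq_range hlam0 hlam1]
  rintro _ ⟨b, rfl⟩
  exact abs_lt.1 (abs_code_lt hlam0 hlam1 b)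

lemma code_injective (hlam0 : 0 < lam) (hlam1 : lam < 1 / 3) :
    Function.Injective (code lam) := by
  -- the sign of the sum is its leading sign
  have hsign : ∀ b, b 0 = true ↔ 0 < code lam b := by
    intro b
    have h := abs_lt.1 (abs_code_lt hlam0 hlam1 fun n => b (n + 1))
    have hpi := Real.pi_pos
    rw [code_eq hlam0 hlam1, ← mul_add, mul_pos_iff_of_pos_left hlam0]
    cases b 0 <;> simp [signOf] <;> linarith [h.1, h.2]
  have key : ∀ n : ℕ, ∀ b b' : ℕ → Bool, code lam b = code lam b' → b n = b' n := by
    intro n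
    induction n with
    | zero =>
      intro b b' h
      rw [Bool.eq_iff_iff, hsign, hsign, h]
    | succ n ih =>
      intro b b' h
      have h0 : b 0 = b' 0 := by rw [Bool.eq_iff_iff, hsign, hsign, h]
      rw [code_eq hlam0 hlam1 b, code_eq hlam0 hlam1 b', h0] at h
      exact ih _ _ (mul_left_cancel₀ hlam0.ne' (add_left_cancel h))
  exact fun b b' h => funext fun n => key n b b' h

lemma continuous_code (hlam0 : 0 < lam) (hlam1 : lam < 1 / 3) : Continuous (code lam) := by
  refine continuous_tsum (fun n => ?_) (hasSum_bound hlam0 hlam1).summable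
    fun n b => norm_code_term_le hlam0 (b n) n
  have : Continuous signOf := continuous_of_discreteTopology
  exact continuous_const.mul ((this.comp (continuous_apply n)).mul continuous_const)

lemma isCantorSet_C (hlam0 : 0 < lam) (hlam1 : lam < 1 / 3) : IsCantorSet (C lam) :=
  ⟨(Homeomorph.setCongr (C_eq_range hlam0 hlam1)).trans
    ((continuous_code hlam0 hlam1).isClosedEmbedding
      (code_injective hlam0 hlam1)).isEmbedding.toHomeomorph.symm⟩

lemma isCompact_C (hlam0 : 0 < lam) (hlam1 : lam < 1 / 3) : IsCompact (C lam) := by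
  rw [C_eq_range hlam0 hlam1]
  exact isCompact_range (continuous_code hlam0 hlam1)

lemma C_nonempty (hlam0 : 0 < lam) (hlam1 : lam < 1 / 3) : (C lam).Nonempty := by
  rw [C_eq_range hlam0 hlam1]
  exact range_nonempty _

/-- The new angle after a collision with the next side in counterclockwise order. -/
noncomputable def turnRight (lam θ : ℝ) : ℝ := -lam * (θ - Real.pi / 3)

/-- The new angle after a collision with the previous side in counterclockwise order. -/
noncomputable def turnLeft (lam θ : ℝ) : ℝ := -lam * (θ + Real.pi / 3)

lemma turnRight_code (hlam0 : 0 < lam) (hlam1 : lam < 1 / 3) (b : ℕ → Bool) :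
    turnRight lam (code lam b) = code lam (Nat.rec true fun n _ => !(b n)) := by
  rw [code_eq hlam0 hlam1 (Nat.rec true fun n _ => !(b n)), code_not, turnRight]
  simp only [signOf]
  norm_num
  ring

lemma turnLeft_code (hlam0 : 0 < lam) (hlam1 : lam < 1 / 3) (b : ℕ → Bool) :
    turnLeft lam (code lam b) = code lam (Nat.rec false fun n _ => !(b n)) := by
  rw [code_eq hlam0 hlam1 (Nat.rec false fun n _ => !(b n)), code_not, turnLeft]
  simp only [signOf]
  norm_num
  ring

lemma turnRight_mem (hlam0 : 0 < lam) (hlam1 : lam < 1 / 3) {θ : ℝ} (hθ : θ ∈ C lam) :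
    turnRight lam θ ∈ C lam := by
  rw [C_eq_range hlam0 hlam1] at *
  obtain ⟨b, rfl⟩ := hθ
  exact ⟨_, (turnRight_code hlam0 hlam1 b).symm⟩

lemma turnLeft_mem (hlam0 : 0 < lam) (hlam1 : lam < 1 / 3) {θ : ℝ} (hθ : θ ∈ C lam) :
    turnLeft lam θ ∈ C lam := by
  rw [C_eq_range hlam0 hlam1] at *
  obtain ⟨b, rfl⟩ := hθ
  exact ⟨_, (turnLeft_code hlam0 hlam1 b).symm⟩

lemma C_cover (hlam0 : 0 < lam) (hlam1 : lam < 1 / 3) {θ : ℝ} (hθ : θ ∈ C lam) :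
    (∃ θ' ∈ C lam, turnRight lam θ' = θ) ∨ ∃ θ' ∈ C lam, turnLeft lam θ' = θ := by
  rw [C_eq_range hlam0 hlam1] at *
  obtain ⟨b, rfl⟩ := hθ
  have hb : ∀ c, b 0 = c → (Nat.rec c fun n _ => !(!(b (n + 1))) : ℕ → Bool) = b := by
    rintro c rfl
    ext n
    cases n <;> simp
  cases h : b 0
  · right
    refine ⟨_, ⟨fun n => !(b (n + 1)), rfl⟩, ?_⟩
    rw [turnLeft_code hlam0 hlam1, hb _ h]
  · left
    refine ⟨_, ⟨fun n => !(b (n + 1)), rfl⟩, ?_⟩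
    rw [turnRight_code hlam0 hlam1, hb _ h]

lemma dist_turnRight (hlam0 : 0 < lam) (θ θ' : ℝ) :
    dist (turnRight lam θ) (turnRight lam θ') = lam * dist θ θ' := by
  rw [Real.dist_eq, Real.dist_eq, turnRight, turnRight, ← abs_of_pos hlam0, ← abs_mul, ← abs_neg,
    abs_of_pos hlam0]
  congr 1
  ring

lemma dist_turnLeft (hlam0 : 0 < lam) (θ θ' : ℝ) :
    dist (turnLeft lam θ) (turnLeft lam θ') = lam * dist θ θ' := by
  rw [Real.dist_eq, Real.dist_eq, turnLeft, turnLeft, ← abs_of_pos hlam0, ← abs_mul, ← abs_neg,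
    abs_of_pos hlam0]
  congr 1
  ring

/-! ### The attractor -/

lemma mem_fullSpace_of_mem (hlam0 : 0 < lam) (hlam1 : lam < 1 / 3) {p : ℝ × ℝ}
    (hp : p ∈ Icc (0 : ℝ) 3 ×ˢ C lam) : p ∈ fullSpace := by
  have := C_subset hlam0 hlam1 hp.2
  exact ⟨hp.1, by linarith [this.1, Real.pi_pos], by linarith [this.2, Real.pi_pos]⟩

lemma mem_diff_Sing_iff (hlam0 : 0 < lam) (hlam1 : lam < 1 / 3) {p : ℝ × ℝ} :
    p ∈ (Icc 0 3 ×ˢ C lam) \ Sing lam ↔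
      p ∈ Icc 0 3 ×ˢ C lam ∧ ∀ n : ℕ, (T lam)^[n] p ∈ domain lam := by
  refine and_congr_right fun hp => ?_
  simp [Sing, mem_fullSpace_of_mem hlam0 hlam1 hp]

lemma T_mem_diff_Sing (hlam0 : 0 < lam) (hlam1 : lam < 1 / 3) {p : ℝ × ℝ}
    (hp : p ∈ (Icc 0 3 ×ˢ C lam) \ Sing lam) : T lam p ∈ (Icc 0 3 ×ˢ C lam) \ Sing lam := by
  rw [mem_diff_Sing_iff hlam0 hlam1] at hp ⊢
  obtain ⟨⟨h1, h2⟩, h3⟩ := hp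
  have h0 : p ∈ domain lam := h3 0
  refine ⟨⟨sides_subset_Icc (fst_T_mem_sides h0), ?_⟩, fun n => ?_⟩
  · rcases snd_T h0 with h | h <;> rw [h]
    · exact turnRight_mem hlam0 hlam1 h2
    · exact turnLeft_mem hlam0 hlam1 h2
  · simpa only [Function.iterate_succ_apply] using h3 (n + 1)

/-- Every nonsingular point over `C lam` has a nonsingular preimage over `C lam`: the angle has a
preimage in `C lam`, for which the two branches of the collision map onto whole sides. -/
lemma exists_T_eq (hlam0 : 0 < lam) (hlam1 : lam < 1 / 3) {q : ℝ × ℝ}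
    (hq : q ∈ (Icc 0 3 ×ˢ C lam) \ Sing lam) :
    ∃ p ∈ (Icc 0 3 ×ˢ C lam) \ Sing lam, T lam p = q := by
  rw [mem_diff_Sing_iff hlam0 hlam1] at hq
  obtain ⟨⟨-, h2⟩, h3⟩ := hq
  -- it suffices to find a preimage in the domain
  suffices h : ∃ p ∈ Icc (0 : ℝ) 3 ×ˢ C lam, p ∈ domain lam ∧ T lam p = q by
    obtain ⟨p, hp, hpd, hT⟩ := h
    refine ⟨p, (mem_diff_Sing_iff hlam0 hlam1).2 ⟨hp, fun n => ?_⟩, hT⟩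
    cases n with
    | zero => exact hpd
    | succ n => rw [Function.iterate_succ_apply, hT]; exact h3 n
  obtain ⟨s, φ⟩ := q
  obtain ⟨j, y, hy, rfl⟩ := mem_sides_iff.1 (mem_domain_iff.1 (h3 0)).1
  have hpi := Real.pi_pos
  rcases C_cover hlam0 hlam1 h2 with ⟨θ, hθ, hφ⟩ | ⟨θ, hθ, hφ⟩
  · have hθ6 := C_subset hlam0 hlam1 hθ
    have hθ2 : θ ∈ Ioo (-(Real.pi / 2)) (Real.pi / 2) :=
      ⟨by linarith [hθ6.1], by linarith [hθ6.2]⟩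
    have hw := (hitWeight_pos_iff hθ2).2 hθ6.1
    have hw' := (one_sub_hitWeight_pos_iff hθ2).2 hθ6.2
    have hx : 1 - y * hitWeight θ ∈ Ioo (0 : ℝ) 1 := by
      constructor <;> nlinarith [hy.1, hy.2]
    have hxw : 1 - (1 - y * hitWeight θ) < hitWeight θ := by nlinarith [hy.2]
    refine ⟨(arc (j - 1) (1 - y * hitWeight θ), θ),
      ⟨sides_subset_Icc (arc_mem_sides _ hx), hθ⟩, ⟨_, step_add_one hx hθ2 hxw⟩, ?_⟩
    rw [T_add_one hx hθ2 hxw, sub_add_cancel, sub_sub_cancel, mul_div_cancel_right₀ _ hw.ne']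
    exact congrArg _ hφ
  · have hθ6 := C_subset hlam0 hlam1 hθ
    have hθ2 : θ ∈ Ioo (-(Real.pi / 2)) (Real.pi / 2) :=
      ⟨by linarith [hθ6.1], by linarith [hθ6.2]⟩
    have hw := (hitWeight_pos_iff hθ2).2 hθ6.1
    have hw' := (one_sub_hitWeight_pos_iff hθ2).2 hθ6.2
    have hx : (1 - y) * (1 - hitWeight θ) ∈ Ioo (0 : ℝ) 1 := by
      constructor <;> nlinarith [hy.1, hy.2]
    have hxw : (1 - y) * (1 - hitWeight θ) < 1 - hitWeight θ := by nlinarith [hy.1]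
    refine ⟨(arc (j + 1) ((1 - y) * (1 - hitWeight θ)), θ),
      ⟨sides_subset_Icc (arc_mem_sides _ hx), hθ⟩, ⟨_, step_sub_one hx hθ2 hxw⟩, ?_⟩
    rw [T_sub_one hx hθ2 hxw, add_sub_cancel_right, mul_div_cancel_right₀ _ hw'.ne', sub_sub_cancel]
    exact congrArg _ hφ

lemma image_T_diff_Sing (hlam0 : 0 < lam) (hlam1 : lam < 1 / 3) :
    T lam '' ((Icc 0 3 ×ˢ C lam) \ Sing lam) = (Icc 0 3 ×ˢ C lam) \ Sing lam := by
  refine Subset.antisymm ?_ fun q hq => ?_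
  · rintro _ ⟨p, hp, rfl⟩
    exact T_mem_diff_Sing hlam0 hlam1 hp
  · obtain ⟨p, hp, hT⟩ := exists_T_eq hlam0 hlam1 hq
    exact ⟨p, hp, hT⟩

lemma image_iterate_T_diff_Sing (hlam0 : 0 < lam) (hlam1 : lam < 1 / 3) (n : ℕ) :
    (T lam)^[n] '' ((Icc 0 3 ×ˢ C lam) \ Sing lam) = (Icc 0 3 ×ˢ C lam) \ Sing lam := by
  induction n with
  | zero => simp
  | succ n ih => rw [Function.iterate_succ, image_comp, image_T_diff_Sing hlam0 hlam1, ih]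

lemma infDist_T_le (hlam0 : 0 < lam) (hlam1 : lam < 1 / 3) {p : ℝ × ℝ} (hp : p ∈ domain lam) :
    Metric.infDist (T lam p).2 (C lam) ≤ lam * Metric.infDist p.2 (C lam) := by
  rw [← div_le_iff₀' hlam0, Metric.le_infDist (C_nonempty hlam0 hlam1)]
  intro θ hθ
  rw [div_le_iff₀' hlam0]
  rcases snd_T hp with h | h <;> rw [h]
  · exact (Metric.infDist_le_dist_of_mem (turnRight_mem hlam0 hlam1 hθ)).trans
      (dist_turnRight hlam0 _ _).le
  · exact (Metric.infDist_le_dist_of_mem (turnLeft_mem hlam0 hlam1 hθ)).trans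
      (dist_turnLeft hlam0 _ _).le

lemma infDist_iterate_T_le (hlam0 : 0 < lam) (hlam1 : lam < 1 / 3) {p : ℝ × ℝ}
    (hp : ∀ n : ℕ, (T lam)^[n] p ∈ domain lam) (n : ℕ) :
    Metric.infDist ((T lam)^[n] p).2 (C lam) ≤ lam ^ n * Metric.infDist p.2 (C lam) := by
  induction n with
  | zero => simp
  | succ n ih =>
    rw [Function.iterate_succ_apply', pow_succ', mul_assoc]
    exact (infDist_T_le hlam0 hlam1 (hp n)).trans (mul_le_mul_of_nonneg_left ih hlam0.le)

lemma attractor_eq (hlam0 : 0 < lam) (hlam1 : lam < 1 / 3) :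
    attractor lam = (Icc 0 3 ×ˢ C lam) \ Sing lam := by
  refine Subset.antisymm (fun p hp => ?_) (fun p hp => mem_iInter.2 fun n => ?_)
  · rw [attractor, mem_iInter] at hp
    obtain ⟨_, ⟨hfull, hsing⟩, rfl⟩ := hp 0
    refine ⟨⟨hfull.1, ?_⟩, hsing⟩
    simp only [Function.iterate_zero, id_eq] at hp ⊢
    rename_i p
    obtain ⟨θ₀, hθ₀⟩ := C_nonempty hlam0 hlam1
    have hθ₀' := C_subset hlam0 hlam1 hθ₀
    have hbound : ∀ n : ℕ, Metric.infDist p.2 (C lam) ≤ lam ^ n * Real.pi := by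
      intro n
      obtain ⟨q, ⟨hq, hqs⟩, hqp⟩ := hp n
      have hq' : ∀ n : ℕ, (T lam)^[n] q ∈ domain lam := by
        by_contra hcon
        push Not at hcon
        exact hqs ⟨hq, hcon⟩
      rw [← hqp]
      refine (infDist_iterate_T_le hlam0 hlam1 hq' n).trans
        (mul_le_mul_of_nonneg_left ?_ (pow_nonneg hlam0.le n))
      refine (Metric.infDist_le_dist_of_mem hθ₀).trans ?_
      rw [Real.dist_eq, abs_le]
      exact ⟨by linarith [hq.2.1, hθ₀'.2, Real.pi_pos], by linarith [hq.2.2, hθ₀'.1, Real.pi_pos]⟩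
    have hlim : Tendsto (fun n : ℕ => lam ^ n * Real.pi) atTop (𝓝 0) := by
      simpa using (tendsto_pow_atTop_nhds_zero_of_lt_one hlam0.le
        (by linarith : lam < 1)).mul_const Real.pi
    have h0 : Metric.infDist p.2 (C lam) = 0 :=
      le_antisymm (ge_of_tendsto' hlim hbound) Metric.infDist_nonneg
    exact ((isCompact_C hlam0 hlam1).isClosed.mem_iff_infDist_zero ⟨θ₀, hθ₀⟩).2 h0
  · have := image_iterate_T_diff_Sing hlam0 hlam1 n
    rw [← this] at hp
    obtain ⟨q, hq, rfl⟩ := hp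
    exact ⟨q, ⟨mem_fullSpace_of_mem hlam0 hlam1 hq.1, hq.2⟩, rfl⟩

end Pinball

/-! ### The invariant measure on the attractor -/

namespace Pinball

variable {lam : ℝ}

lemma abs_hitWeight_sub_le {u v : ℝ} (hu : u ∈ Ioo (-(Real.pi / 6)) (Real.pi / 6))
    (hv : v ∈ Ioo (-(Real.pi / 6)) (Real.pi / 6)) : |hitWeight u - hitWeight v| ≤ 2 * |u - v| := by
  have hpi := Real.pi_pos
  have hcos : ∀ x ∈ Ioo (-(Real.pi / 6)) (Real.pi / 6), √3 / 2 ≤ Real.cos x := by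
    intro x hx
    rw [← Real.cos_pi_div_six, ← Real.cos_abs x]
    exact Real.cos_le_cos_of_nonneg_of_le_pi (abs_nonneg _) (by linarith) (abs_lt.2 hx).le
  have h3 := sqrt_three_mul_self
  have hs : 0 < √3 := by positivity
  have hs2 : √3 ≤ 2 := by nlinarith
  have cu := hcos u hu
  have cv := hcos v hv
  have cu0 : 0 < Real.cos u := by linarith
  have cv0 : 0 < Real.cos v := by linarith
  have hcc : 3 / 4 ≤ Real.cos u * Real.cos v := by
    calc (3 / 4 : ℝ) = √3 / 2 * (√3 / 2) := by linarith
      _ ≤ _ := mul_le_mul cu cv (by positivity) cu0.le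
  have e : hitWeight u - hitWeight v = √3 / 2 * (Real.sin (u - v) / (Real.cos u * Real.cos v)) := by
    rw [hitWeight, hitWeight, Real.tan_eq_sin_div_cos, Real.tan_eq_sin_div_cos, Real.sin_sub]
    field_simp
    ring
  rw [e, abs_mul, abs_of_pos (by positivity : 0 < √3 / 2), abs_div, abs_of_pos (mul_pos cu0 cv0)]
  have h1 : |Real.sin (u - v)| / (Real.cos u * Real.cos v) ≤ 2 * |u - v| := by
    rw [div_le_iff₀ (mul_pos cu0 cv0)]
    have := Real.abs_sin_le_abs (x := u - v)
    nlinarith [abs_nonneg (u - v)]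
  have h0 : 0 ≤ |Real.sin (u - v)| / (Real.cos u * Real.cos v) := by positivity
  nlinarith

lemma exists_floor (hlam0 : 0 < lam) (hlam1 : lam < 1 / 3) :
    ∃ δ > 0, ∀ θ ∈ C lam, δ ≤ hitWeight θ ∧ δ ≤ 1 - hitWeight θ := by
  have hsub := C_subset hlam0 hlam1
  have hpi := Real.pi_pos
  have hcont : ContinuousOn hitWeight (C lam) := by
    refine (LipschitzOnWith.of_dist_le_mul (K := 2) fun u hu v hv => ?_).continuousOn
    exact abs_hitWeight_sub_le (hsub hu) (hsub hv)
  obtain ⟨u, hu, hmin⟩ := (isCompact_C hlam0 hlam1).exists_isMinOn (C_nonempty hlam0 hlam1)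
    (hcont.inf (continuousOn_const (c := (1 : ℝ)) |>.sub hcont))
  have hu2 : u ∈ Ioo (-(Real.pi / 2)) (Real.pi / 2) :=
    ⟨by linarith [(hsub hu).1], by linarith [(hsub hu).2]⟩
  refine ⟨min (hitWeight u) (1 - hitWeight u), lt_min ((hitWeight_pos_iff hu2).2 (hsub hu).1)
    ((one_sub_hitWeight_pos_iff hu2).2 (hsub hu).2), fun θ hθ => ?_⟩
  exact le_min_iff.1 (hmin hθ)

/-- The random motion of the angle in `C lam` that a collision of a particle with uniformly
distributed position causes. -/
noncomputable def angleIFS (hlam0 : 0 < lam) (hlam1 : lam < 1 / 3) : PlaceIFS (C lam) where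
  right θ := ⟨turnRight lam θ, turnRight_mem hlam0 hlam1 θ.2⟩
  left θ := ⟨turnLeft lam θ, turnLeft_mem hlam0 hlam1 θ.2⟩
  weight θ := hitWeight θ
  ratio := lam
  slope := 2
  floor := (exists_floor hlam0 hlam1).choose
  ratio_nonneg := hlam0.le
  ratio_lt_one := by linarith
  floor_pos := (exists_floor hlam0 hlam1).choose_spec.1
  dist_right a b := (dist_turnRight hlam0 a b).le
  dist_left a b := (dist_turnLeft hlam0 a b).le
  abs_weight_sub_le a b := abs_hitWeight_sub_le (C_subset hlam0 hlam1 a.2) (C_subset hlam0 hlam1 b.2)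
  floor_le_weight a := ((exists_floor hlam0 hlam1).choose_spec.2 a a.2).1
  floor_le_one_sub_weight a := ((exists_floor hlam0 hlam1).choose_spec.2 a a.2).2

/-- The phase point with the given side, distance from the start of this side, and angle. -/
noncomputable def toPhase (lam : ℝ) : (Fin 3 × ℝ) × C lam → ℝ × ℝ :=
  Prod.map (fun q => arc q.1 q.2) Subtype.val

lemma continuous_toPhase : Continuous (toPhase lam) := by
  have : Continuous fun i : Fin 3 => ((i : ℕ) : ℝ) := continuous_of_discreteTopology
  exact ((this.comp continuous_fst).add continuous_snd).prodMap continuous_subtype_val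

/-- The uniform probability measure on the boundary of the triangle. -/
noncomputable def boundaryMeasure : Measure ℝ :=
  PlaceIFS.circleLeb.map fun q : Fin 3 × ℝ => arc q.1 q.2

lemma measurable_arc_prod : Measurable fun q : Fin 3 × ℝ => arc q.1 q.2 :=
  measurable_arc measurable_fst measurable_snd

instance : IsProbabilityMeasure boundaryMeasure :=
  Measure.isProbabilityMeasure_map measurable_arc_prod.aemeasurable

lemma boundaryMeasure_absolutelyContinuous : boundaryMeasure ≪ (volume : Measure ℝ) := by
  refine Measure.AbsolutelyContinuous.mk fun s hs h0 => ?_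
  have hs' := measurable_arc_prod hs
  rw [boundaryMeasure, Measure.map_apply measurable_arc_prod hs, ← lintegral_indicator_one hs',
    PlaceIFS.lintegral_circleLeb (measurable_one.indicator hs')]
  have hz : ∀ i : Fin 3, ∫⁻ x, ((fun q : Fin 3 × ℝ => arc q.1 q.2) ⁻¹' s).indicator 1 (i, x)
      ∂unitLeb = 0 := by
    intro i
    have hm : MeasurableSet ((fun x : ℝ => ((i : ℕ) : ℝ) + x) ⁻¹' s) :=
      measurable_const_add _ hs
    have : ∀ x : ℝ, ((fun q : Fin 3 × ℝ => arc q.1 q.2) ⁻¹' s).indicator (1 : Fin 3 × ℝ → ENNReal) (i, x) =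
        ((fun x : ℝ => ((i : ℕ) : ℝ) + x) ⁻¹' s).indicator 1 x := fun x => rfl
    simp only [this]
    rw [lintegral_indicator_one hm]
    refine le_antisymm ((Measure.restrict_apply_le _ _).trans ?_) zero_le
    rw [measure_preimage_add, h0]
  simp [hz]

/-- A property of the points of the skew product holds almost everywhere if it holds almost
everywhere on each copy of the unit interval. -/
lemma ae_circleLeb_prod {K : Type*} [MeasurableSpace K] {ν : Measure K} [IsProbabilityMeasure ν]
    {s : Set ((Fin 3 × ℝ) × K)} (hs : MeasurableSet s)
    (h : ∀ i a, ∀ᵐ x ∂unitLeb, ((i, x), a) ∈ s) : ∀ᵐ p ∂(PlaceIFS.circleLeb.prod ν), p ∈ s := by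
  have hm : Measurable (sᶜ.indicator (1 : (Fin 3 × ℝ) × K → ENNReal)) :=
    measurable_one.indicator hs.compl
  change (PlaceIFS.circleLeb.prod ν) sᶜ = 0
  rw [← lintegral_indicator_one hs.compl, lintegral_prod_symm' _ hm]
  refine (lintegral_congr fun a => ?_).trans lintegral_zero
  rw [PlaceIFS.lintegral_circleLeb (F := fun q => sᶜ.indicator 1 (q, a))
    (hm.comp (by fun_prop : Measurable fun q : Fin 3 × ℝ => (q, a)))]
  have : ∀ i : Fin 3, ∫⁻ x, sᶜ.indicator (1 : (Fin 3 × ℝ) × K → ENNReal) ((i, x), a) ∂unitLeb = 0 := by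
    intro i
    refine (lintegral_congr_ae ?_).trans lintegral_zero
    filter_upwards [h i a] with x hx
    exact indicator_of_notMem (by simpa using hx) _
  simp [this]

/-- Off the null set of points on trajectories into a vertex, the skew product over `angleIFS` is
the pinball billiard map in coordinates. -/
lemma ae_mem_and_T_toPhase (hlam0 : 0 < lam) (hlam1 : lam < 1 / 3) {ν : Measure (C lam)}
    [IsProbabilityMeasure ν] : ∀ᵐ p ∂(PlaceIFS.circleLeb.prod ν), toPhase lam p ∈ domain lam ∧
      T lam (toPhase lam p) = toPhase lam ((angleIFS hlam0 hlam1).skew p) := by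
  have hpi := Real.pi_pos
  have hs : MeasurableSet {p : (Fin 3 × ℝ) × C lam | p.1.2 ∈ Ioo (0 : ℝ) 1 ∧
      p.1.2 ≠ 1 - hitWeight p.2} := by
    have hw := measurable_hitWeight
    refine ((by fun_prop : Measurable fun p : (Fin 3 × ℝ) × C lam => p.1.2)
      measurableSet_Ioo).inter (MeasurableSet.compl ?_)
    exact measurableSet_eq_fun (by fun_prop) (by fun_prop)
  have hae := ae_circleLeb_prod (ν := ν) hs fun i a => by
    have h1 : ∀ᵐ x ∂unitLeb, x ∈ Ioo (0 : ℝ) 1 := ae_restrict_mem measurableSet_Ioo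
    have h2 : ∀ᵐ x ∂unitLeb, x ≠ 1 - hitWeight a :=
      ae_restrict_of_ae (Measure.ae_ne volume _)
    filter_upwards [h1, h2] with x hx hx' using ⟨hx, hx'⟩
  filter_upwards [hae] with ⟨⟨i, x⟩, θ⟩ ⟨hx, hne⟩
  have hθ6 := C_subset hlam0 hlam1 θ.2
  have hθ : (θ : ℝ) ∈ Ioo (-(Real.pi / 2)) (Real.pi / 2) :=
    ⟨by linarith [hθ6.1], by linarith [hθ6.2]⟩
  simp only at hx hne
  change (arc i x, (θ : ℝ)) ∈ domain lam ∧ T lam (arc i x, (θ : ℝ)) = _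
  have hweight : (angleIFS hlam0 hlam1).weight θ = hitWeight θ := rfl
  rcases lt_or_gt_of_ne hne with h | h
  · refine ⟨⟨_, step_sub_one hx hθ h⟩, ?_⟩
    rw [T_sub_one hx hθ h, PlaceIFS.skew, if_neg (by rw [hweight]; exact h.not_gt)]
    rfl
  · refine ⟨⟨_, step_add_one hx hθ (by linarith)⟩, ?_⟩
    rw [T_add_one hx hθ (by linarith), PlaceIFS.skew, if_pos (by rw [hweight]; exact h)]
    rfl

lemma measurableSet_attractor (hlam0 : 0 < lam) (hlam1 : lam < 1 / 3) :
    MeasurableSet (attractor lam) := by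
  rw [attractor_eq hlam0 hlam1]
  exact (measurableSet_Icc.prod (isCompact_C hlam0 hlam1).isClosed.measurableSet).diff
    measurableSet_Sing

lemma ae_toPhase_mem_attractor (hlam0 : 0 < lam) (hlam1 : lam < 1 / 3) {ν : Measure (C lam)}
    [IsProbabilityMeasure ν] (hν : (angleIFS hlam0 hlam1).IsStationary ν) :
    ∀ᵐ p ∂(PlaceIFS.circleLeb.prod ν), toPhase lam p ∈ attractor lam := by
  have h := ae_mem_and_T_toPhase hlam0 hlam1 (ν := ν)
  have hall : ∀ᵐ p ∂(PlaceIFS.circleLeb.prod ν), ∀ n : ℕ,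
      toPhase lam ((angleIFS hlam0 hlam1).skew^[n] p) ∈ domain lam ∧
      T lam (toPhase lam ((angleIFS hlam0 hlam1).skew^[n] p)) =
        toPhase lam ((angleIFS hlam0 hlam1).skew ((angleIFS hlam0 hlam1).skew^[n] p)) :=
    ae_all_iff.2 fun n => (hν.measurePreserving_skew.iterate n).quasiMeasurePreserving.ae h
  filter_upwards [hall] with p hp
  have hit : ∀ n : ℕ, (T lam)^[n] (toPhase lam p) =
      toPhase lam ((angleIFS hlam0 hlam1).skew^[n] p) := by
    intro n
    induction n with
    | zero => rfl
    | succ n ih => rw [Function.iterate_succ_apply', ih, (hp n).2, Function.iterate_succ_apply']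
  rw [attractor_eq hlam0 hlam1, mem_diff_Sing_iff hlam0 hlam1]
  refine ⟨⟨sides_subset_Icc (mem_domain_iff.1 (hp 0).1).1, p.2.2⟩, fun n => ?_⟩
  rw [hit]
  exact (hp n).1

/-- The measure on the phase space that is uniform in the boundary point and distributes the angle
according to `ν`. -/
noncomputable def phaseMeasure (ν : Measure (C lam)) : Measure (ℝ × ℝ) :=
  (PlaceIFS.circleLeb.prod ν).map (toPhase lam)

lemma phaseMeasure_eq_prod (ν : Measure (C lam)) [IsProbabilityMeasure ν] :
    phaseMeasure ν = boundaryMeasure.prod (ν.map Subtype.val) := by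
  rw [phaseMeasure, toPhase, boundaryMeasure,
    Measure.map_prod_map _ _ measurable_arc_prod measurable_subtype_coe]

instance (ν : Measure (C lam)) [IsProbabilityMeasure ν] : IsProbabilityMeasure (phaseMeasure ν) :=
  Measure.isProbabilityMeasure_map continuous_toPhase.measurable.aemeasurable

lemma ergodic_T (hlam0 : 0 < lam) (hlam1 : lam < 1 / 3) {ν : Measure (C lam)}
    [IsProbabilityMeasure ν] (hν : (angleIFS hlam0 hlam1).IsStationary ν) :
    Ergodic (T lam) (phaseMeasure ν) := by
  have hphase := (continuous_toPhase (lam := lam)).measurable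
  have hcomm := ae_mem_and_T_toPhase hlam0 hlam1 (ν := ν)
  have : CompactSpace (C lam) := isCompact_iff_compactSpace.1 (isCompact_C hlam0 hlam1)
  have herg := hν.ergodic_skew
  refine ⟨⟨measurable_T, ?_⟩, ⟨fun {A} hA hinv => ?_⟩⟩
  · have hmap := hν.measurePreserving_skew.map_eq
    conv_rhs => rw [phaseMeasure, ← hmap]
    rw [phaseMeasure, Measure.map_map measurable_T hphase,
      Measure.map_map hphase (PlaceIFS.measurable_skew _)]
    refine Measure.map_congr ?_
    filter_upwards [hcomm] with p hp using hp.2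
  · have hA' := hphase hA
    have hinv' : (angleIFS hlam0 hlam1).skew ⁻¹' (toPhase lam ⁻¹' A)
        =ᵐ[PlaceIFS.circleLeb.prod ν] toPhase lam ⁻¹' A := by
      filter_upwards [hcomm] with p hp
      refine propext ?_
      change toPhase lam ((angleIFS hlam0 hlam1).skew p) ∈ A ↔ toPhase lam p ∈ A
      rw [← hp.2, ← mem_preimage, hinv]
    rcases herg.quasiErgodic.ae_empty_or_univ₀ hA'.nullMeasurableSet hinv' with h | h
    · refine eventuallyConst_set'.2 (.inl (ae_eq_empty.2 ?_))
      rw [phaseMeasure, Measure.map_apply hphase hA]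
      exact ae_eq_empty.1 h
    · refine eventuallyConst_set'.2 (.inr (ae_eq_univ.2 ?_))
      rw [phaseMeasure, Measure.map_apply hphase hA.compl]
      exact ae_eq_univ.1 h

lemma phaseMeasure_pos (hlam0 : 0 < lam) (hlam1 : lam < 1 / 3) {ν : Measure (C lam)}
    [IsProbabilityMeasure ν] (hν : (angleIFS hlam0 hlam1).IsStationary ν) {U : Set (ℝ × ℝ)}
    (hU : IsOpen U) (hne : (U ∩ attractor lam).Nonempty) : 0 < phaseMeasure ν U := by
  have : CompactSpace (C lam) := isCompact_iff_compactSpace.1 (isCompact_C hlam0 hlam1)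
  obtain ⟨⟨s, θ⟩, hpU, hp⟩ := hne
  rw [attractor_eq hlam0 hlam1, mem_diff_Sing_iff hlam0 hlam1] at hp
  obtain ⟨i, x, hx, rfl⟩ := mem_sides_iff.1 (mem_domain_iff.1 (hp.2 0)).1
  have hθ : θ ∈ C lam := hp.1.2
  have hopen : IsOpen {q : ℝ × C lam | q.1 ∈ Ioo (0 : ℝ) 1 ∧ toPhase lam ((i, q.1), q.2) ∈ U} :=
    (isOpen_Ioo.preimage continuous_fst).inter (hU.preimage (continuous_toPhase.comp (by fun_prop)))
  obtain ⟨r, hr, hball⟩ := Metric.isOpen_iff.1 hopen (x, ⟨θ, hθ⟩) ⟨hx, hpU⟩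
  rw [← ball_prod_same] at hball
  have hsub : ({i} ×ˢ Metric.ball x r) ×ˢ Metric.ball (⟨θ, hθ⟩ : C lam) r ⊆ toPhase lam ⁻¹' U := by
    rintro ⟨⟨j, y⟩, φ⟩ ⟨⟨hj, hy⟩, hφ⟩
    obtain rfl : j = i := hj
    exact (hball (show (y, φ) ∈ _ from ⟨hy, hφ⟩)).2
  have hIoo : Metric.ball x r ⊆ Ioo 0 1 := fun y hy =>
    (hball (show (y, ⟨θ, hθ⟩) ∈ _ from ⟨hy, Metric.mem_ball_self hr⟩)).1
  rw [phaseMeasure, Measure.map_apply continuous_toPhase.measurable hU.measurableSet]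
  refine lt_of_lt_of_le ?_ (measure_mono hsub)
  rw [Measure.prod_prod, PlaceIFS.circleLeb, Measure.prod_prod]
  refine ENNReal.mul_pos (mul_ne_zero ?_ ?_) ?_
  · simp
  · rw [unitLeb, Measure.restrict_apply measurableSet_ball, inter_eq_left.2 hIoo]
    exact (Metric.measure_ball_pos _ _ hr).ne'
  · refine (hν.ball_pos (fun a => ?_) _ hr).ne'
    rcases C_cover hlam0 hlam1 a.2 with ⟨b, hb, h⟩ | ⟨b, hb, h⟩
    · exact .inl ⟨⟨b, hb⟩, Subtype.ext h⟩
    · exact .inr ⟨⟨b, hb⟩, Subtype.ext h⟩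

lemma phaseMeasure_compl_attractor (hlam0 : 0 < lam) (hlam1 : lam < 1 / 3) {ν : Measure (C lam)}
    [IsProbabilityMeasure ν] (hν : (angleIFS hlam0 hlam1).IsStationary ν) :
    phaseMeasure ν (attractor lam)ᶜ = 0 := by
  rw [phaseMeasure, Measure.map_apply continuous_toPhase.measurable
    (measurableSet_attractor hlam0 hlam1).compl]
  exact ae_toPhase_mem_attractor hlam0 hlam1 hν

/-- An ergodic measure with full support on the attractor makes the map transitive: the points
that eventually visit an open set have full measure. -/
lemma isTransitiveOn_attractor (hlam0 : 0 < lam) (hlam1 : lam < 1 / 3) {ν : Measure (C lam)}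
    [IsProbabilityMeasure ν] (hν : (angleIFS hlam0 hlam1).IsStationary ν) :
    IsTransitiveOn (T lam) (attractor lam) := by
  intro U V hU hV hUne hVne
  have hpos := phaseMeasure_pos hlam0 hlam1 hν hU hUne
  have hposV := phaseMeasure_pos hlam0 hlam1 hν hV hVne
  set W : Set (ℝ × ℝ) := ⋃ n : ℕ, (T lam)^[n] ⁻¹' V with hW
  have hWm : MeasurableSet W := .iUnion fun n => measurable_T.iterate n hV.measurableSet
  have hWinv : T lam ⁻¹' W ⊆ W := by
    intro p hp
    obtain ⟨n, hn⟩ := mem_iUnion.1 hp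
    exact mem_iUnion.2 ⟨n + 1, hn⟩
  have hWfull : W =ᵐ[phaseMeasure ν] univ := by
    rcases (ergodic_T hlam0 hlam1 hν).ae_empty_or_univ_of_preimage_ae_le hWm.nullMeasurableSet
      hWinv.eventuallyLE with h | h
    · have h0 : phaseMeasure ν W = 0 := ae_eq_empty.1 h
      have : V ⊆ W := subset_iUnion (fun n : ℕ => (T lam)^[n] ⁻¹' V) 0
      exact (hposV.ne' (measure_mono_null this h0)).elim
    · exact h
  have hae : ∀ᵐ p ∂(phaseMeasure ν), p ∈ W ∧ p ∈ attractor lam := by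
    have h1 : ∀ᵐ p ∂(phaseMeasure ν), p ∈ W := ae_eq_univ.1 hWfull
    have h2 : ∀ᵐ p ∂(phaseMeasure ν), p ∈ attractor lam :=
      phaseMeasure_compl_attractor hlam0 hlam1 hν
    exact h1.and h2
  obtain ⟨u, huU, huW, huA⟩ : ∃ u ∈ U, u ∈ W ∧ u ∈ attractor lam := by
    by_contra hcon
    push Not at hcon
    refine hpos.ne' (measure_mono_null (fun u hu => ?_) hae)
    exact fun h => hcon u hu h.1 h.2
  obtain ⟨n, hn⟩ := mem_iUnion.1 huW
  refine ⟨n, _, ⟨u, ⟨huU, huA⟩, rfl⟩, hn, ?_⟩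
  rw [attractor_eq hlam0 hlam1] at huA ⊢
  rw [← image_iterate_T_diff_Sing hlam0 hlam1 n]
  exact mem_image_of_mem _ huA

lemma isCondKernel_phaseMeasure (ν : Measure (C lam)) [IsProbabilityMeasure ν] :
    ((phaseMeasure ν).map Prod.swap).IsCondKernel (Kernel.const ℝ boundaryMeasure) := by
  have : IsProbabilityMeasure (ν.map Subtype.val) :=
    Measure.isProbabilityMeasure_map measurable_subtype_coe.aemeasurable
  have h : (phaseMeasure ν).map Prod.swap = (ν.map Subtype.val).prod boundaryMeasure := by
    rw [phaseMeasure_eq_prod, Measure.prod_swap]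
  refine ⟨?_⟩
  rw [h, Measure.compProd_const, Measure.fst_prod]

end Pinball

theorem theorem1 (lam : ℝ) (hlam0 : 0 < lam) (hlam1 : lam < 1 / 3) :
    -- the attractor is an invariant set, and the map is transitive on it
    Pinball.T lam '' Pinball.attractor lam = Pinball.attractor lam ∧
    Pinball.IsTransitiveOn (Pinball.T lam) (Pinball.attractor lam) ∧
    -- it is the product of the interval with a Cantor set, without the singular locus
    Pinball.IsCantorSet (Pinball.C lam) ∧
    Pinball.attractor lam = (Icc 0 3 ×ˢ Pinball.C lam) \ Pinball.Sing lam ∧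
    Nonempty (Pinball.attractor lam ≃ₜ
      (((Icc 0 3 ×ˢ Pinball.C lam) \ Pinball.Sing lam : Set (ℝ × ℝ)))) ∧
    -- there is an invariant ergodic probability measure on it whose conditional measures on the
    -- horizontal lines are absolutely continuous
    ∃ m : Measure (ℝ × ℝ), IsProbabilityMeasure m ∧ m (Pinball.attractor lam)ᶜ = 0 ∧
      Ergodic (Pinball.T lam) m ∧
      ∃ κ : Kernel ℝ ℝ, IsMarkovKernel κ ∧ (m.map Prod.swap).IsCondKernel κ ∧
        ∀ θ ∈ Pinball.C lam, κ θ ≪ (volume : Measure ℝ) := by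
  have heq := Pinball.attractor_eq hlam0 hlam1
  have : CompactSpace (Pinball.C lam) :=
    isCompact_iff_compactSpace.1 (Pinball.isCompact_C hlam0 hlam1)
  have : Nonempty (Pinball.C lam) := (Pinball.C_nonempty hlam0 hlam1).to_subtype
  obtain ⟨ν, hνp, hν⟩ := (Pinball.angleIFS hlam0 hlam1).exists_isStationary
  refine ⟨by rw [heq, Pinball.image_T_diff_Sing hlam0 hlam1],
    Pinball.isTransitiveOn_attractor hlam0 hlam1 hν, Pinball.isCantorSet_C hlam0 hlam1, heq,
    ⟨Homeomorph.setCongr heq⟩, Pinball.phaseMeasure ν, inferInstance,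
    Pinball.phaseMeasure_compl_attractor hlam0 hlam1 hν, Pinball.ergodic_T hlam0 hlam1 hν,
    Kernel.const ℝ Pinball.boundaryMeasure, inferInstance,
    Pinball.isCondKernel_phaseMeasure ν, fun θ _ => ?_⟩
  rw [Kernel.const_apply]
  exact Pinball.boundaryMeasure_absolutelyContinuous
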